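/- Let $\alpha<\tfrac{15}{7}$ and $s_1,s_2\in\mathbb R$ be real. Write points of $\mathbb R^3$ as $(x,y)$, $x\in\mathbb R$, $y\in\mathbb R^2$, with dual frequencies $(\xi,\eta)$, $\langle z\rangle=(1+|z|^2)^{1/2}$, and let $H^{s_1,s_2}(\mathbb R^3)$ be the space of real-valued tempered distributions $\phi$ with $$\|\phi\|_{H^{s_1,s_2}}=\|\langle\xi\rangle^{s_1}\langle\eta\rangle^{s_2}\hat\phi\|_{L^2_{\xi,\eta}}<\infty .$$ Consider the dispersion-generalized KP-I equation $$\partial_t u-\partial_xD_x^\alpha u-\partial_x^{-1}\Delta_y u=\partial_x(u^2),\qquad u(0)=\phi,$$ where $D_x^\alpha$ has Fourier symbol $|\xi|^\alpha$. A mild solution on $[-T,T]$ is a $u\in C([-T,T];L^2(\mathbb R^3))$ with $$u(t)=S_\alpha(t)\phi+\int_0^tS_\alpha(t-t')\,\partial_x(u(t')^2)\,dt'\quad(|t|\le T),\qquad \widehat{S_\alpha(t)f}=e^{it(|\xi|^\alpha\xi+|\eta|^2/\xi)}\hat f .$$ Let $E^\infty=\bigcap_{\sigma\ge0}E^\sigma$,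 $\|f\|_{E^\sigma}=\|\langle\xi\rangle^\sigma(1+|\eta|/|\xi|)\hat f\|_{L^2_{\xi,\eta}}$. A flow map on $[-T,T]$ is a map $\Gamma$ from $H^{s_1,s_2}(\mathbb R^3)$ to $C([-T,T];H^{s_1,s_2}(\mathbb R^3))$ with $\Gamma(0)=0$ for which there is a neighbourhood $U$ of $0$ in $H^{s_1,s_2}(\mathbb R^3)$ such that: * if $s_1,s_2\ge0$ (so that $H^{s_1,s_2}\subseteq L^2$), then for every $\phi\in U$ the curve $\Gamma(\phi)$ is a mild solution with initial value $\phi$; * if $s_1<0$ or $s_2<0$ (so that $u^2$ is not defined for general $u\in H^{s_1,s_2}$), then $\Gamma$ extends a flow of regular solutions: for every $\phi\in U\cap E^\infty$ the curve $\Gamma(\phi)$ lies in $C([-T,T];E^\infty)$ and is a mild solution with initial value $\phi$. Then there is no $T>0$ for which there exists a flow map $\Gamma$ on $[-T,T]$ that is $C^2$ at the origin as a map from $H^{s_1,s_2}(\mathbb R^3)$ to $C([-T,T];H^{s_1,s_2}(\mathbb R^3))$. (Uniqueness of solutions is not assumed beyond $\Gamma(0)=0$, so in particular there is no $T>0$ for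 which unique solutions on $[-T,T]$ exist and define a flow map that is $C^2$ at the origin.) -/

import Mathlib

open MeasureTheory Set Filter Topology FourierTransform
open scoped SchwartzMap

noncomputable section

namespace KPI

/-- The spatial domain `ℝ³`. A point is `(x, y₁, y₂)`, a frequency is `(ξ, η₁, η₂)`, with `x` and
`ξ` the coordinate of index `0`. -/
abbrev Space : Type := EuclideanSpace ℝ (Fin 3)

/-- Complex-valued square integrable functions on `ℝ³`. -/
abbrev L2 : Type := Lp (α := Space) ℂ 2 (volume : Measure Space)

/-- Tempered distributions on `ℝ³`. -/
abbrev Tempered : Type := 𝓢'(Space, ℂ)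

/-! Mathlib's Fourier transform is `𝓕 f k = ∫ exp (-2 π i ⟨x, k⟩) f x dx`, so that the point `k`
corresponds to the (angular) frequency `(ξ, η) = 2 π k`. -/

/-- The angular frequency `ξ` dual to `x`. -/
def xi (k : Space) : ℝ := 2 * Real.pi * k 0

/-- `|η|²`, where `η` is the angular frequency dual to `y = (y₁, y₂)`. -/
def etaSq (k : Space) : ℝ := (2 * Real.pi * k 1) ^ 2 + (2 * Real.pi * k 2) ^ 2

/-- The weight `⟨ξ⟩ ^ s₁ ⟨η⟩ ^ s₂`, where `⟨z⟩ = (1 + |z|²) ^ (1/2)`. -/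
def weight (s₁ s₂ : ℝ) (k : Space) : ℝ :=
  (1 + xi k ^ 2) ^ (s₁ / 2) * (1 + etaSq k) ^ (s₂ / 2)

/-- The dispersion relation `ω_α(ξ, η) = |ξ| ^ α ξ + |η|² / ξ`. -/
def omega (α : ℝ) (k : Space) : ℝ := |xi k| ^ α * xi k + etaSq k / xi k

theorem weight_hasTemperateGrowth (s₁ s₂ : ℝ) :
    (fun k : Space => (weight s₁ s₂ k : ℂ)).HasTemperateGrowth := by
  have h1 : (fun k : Space => (1 + xi k ^ 2) ^ (s₁ / 2)).HasTemperateGrowth := by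
    let L : Space →L[ℝ] ℝ := (2 * Real.pi) • EuclideanSpace.proj (0 : Fin 3)
    have := (Function.hasTemperateGrowth_one_add_norm_sq_rpow ℝ (s₁ / 2)).comp
      L.hasTemperateGrowth
    convert! this using 2 with k
    simp [L, xi]
  have h2 : (fun k : Space => (1 + etaSq k) ^ (s₂ / 2)).HasTemperateGrowth := by
    let L : Space →L[ℝ] EuclideanSpace ℝ (Fin 2) :=
      (2 * Real.pi) • (PiLp.continuousLinearEquiv 2 ℝ (fun _ : Fin 2 => ℝ)).symm.toContinuousLinearMap.comp
        (ContinuousLinearMap.pi ![EuclideanSpace.proj (1 : Fin 3), EuclideanSpace.proj (2 : Fin 3)])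
    have := (Function.hasTemperateGrowth_one_add_norm_sq_rpow (EuclideanSpace ℝ (Fin 2))
      (s₂ / 2)).comp L.hasTemperateGrowth
    convert! this using 2 with k
    simp only [Function.comp]
    congr 2
    rw [EuclideanSpace.real_norm_sq_eq]
    simp [L, etaSq]
  exact Function.HasTemperateGrowth.comp Function.Complex.hasTemperateGrowth_ofReal (h1.mul h2)

/-- The Fourier multiplier `⟨D_x⟩ ^ s₁ ⟨D_y⟩ ^ s₂` on tempered distributions. -/
def bessel (s₁ s₂ : ℝ) : Tempered →L[ℂ] Tempered :=
  TemperedDistribution.fourierMultiplierCLM ℂ (fun k => (weight s₁ s₂ k : ℂ))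

theorem bessel_neg_bessel (s₁ s₂ : ℝ) (f : Tempered) :
    bessel (-s₁) (-s₂) (bessel s₁ s₂ f) = f := by
  unfold bessel
  rw [TemperedDistribution.fourierMultiplierCLM_fourierMultiplierCLM_apply
    (weight_hasTemperateGrowth _ _) (weight_hasTemperateGrowth _ _)]
  have : ((fun k => (weight (-s₁) (-s₂) k : ℂ)) * fun k => (weight s₁ s₂ k : ℂ))
      = fun _ => (1 : ℂ) := by
    ext k
    have ha : 0 < 1 + xi k ^ 2 := by positivity
    have hb : 0 < 1 + etaSq k := by unfold etaSq; positivity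
    have e1 : (1 + xi k ^ 2) ^ (-s₁ / 2) * (1 + xi k ^ 2) ^ (s₁ / 2) = 1 := by
      rw [← Real.rpow_add ha]; simp [neg_div]
    have e2 : (1 + etaSq k) ^ (-s₂ / 2) * (1 + etaSq k) ^ (s₂ / 2) = 1 := by
      rw [← Real.rpow_add hb]; simp [neg_div]
    have : weight (-s₁) (-s₂) k * weight s₁ s₂ k = 1 := by
      unfold weight
      linear_combination (1 + etaSq k) ^ (-s₂ / 2) * (1 + etaSq k) ^ (s₂ / 2) * e1 + e2
    simp only [Pi.mul_apply]
    exact_mod_cast this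
  rw [mul_comm, this]
  simp

/-- The embedding of `L²` into tempered distributions is injective. -/
theorem coe_L2_injective :
    Function.Injective (Lp.toTemperedDistributionCLM (E := Space) ℂ volume 2) :=
  LinearMap.ker_eq_bot.mp Lp.ker_toTemperedDistributionCLM_eq_bot

/-- A tempered distribution is real-valued if it takes real values on real test functions. -/
def IsRealValued (f : Tempered) : Prop :=
  ∀ ψ : 𝓢(Space, ℂ), (∀ x, (ψ x).im = 0) → (f ψ).im = 0

/-- The real vector space of real-valued tempered distributions `f` on `ℝ³` with
`⟨D_x⟩ ^ s₁ ⟨D_y⟩ ^ s₂ f ∈ L²`. -/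
def sobolevSubmodule (s₁ s₂ : ℝ) : Submodule ℝ Tempered where
  carrier := {f | IsRealValued f ∧ ∃ g : L2, bessel s₁ s₂ f = g}
  zero_mem' := by
    refine ⟨fun ψ _ => by simp, 0, ?_⟩
    rw [← Lp.toTemperedDistributionCLM_apply, map_zero, map_zero]
  add_mem' := by
    rintro a b ⟨ha, g, hg⟩ ⟨hb, h, hh⟩
    refine ⟨fun ψ hψ => ?_, g + h, ?_⟩
    · simp [ha ψ hψ, hb ψ hψ]
    · rw [← Lp.toTemperedDistributionCLM_apply, map_add, map_add, hg, hh]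
      rfl
  smul_mem' := by
    rintro c a ⟨ha, g, hg⟩
    refine ⟨fun ψ hψ => ?_, (c : ℂ) • g, ?_⟩
    · simp [ha ψ hψ]
    · have : c • a = (c : ℂ) • a := by ext ψ; simp
      rw [this, ← Lp.toTemperedDistributionCLM_apply, map_smul, map_smul, hg]
      rfl

/-- The anisotropic Sobolev space `H^{s₁,s₂}(ℝ³)` of real-valued tempered distributions. -/
def Sobolev (s₁ s₂ : ℝ) : Type := sobolevSubmodule s₁ s₂

namespace Sobolev

variable {s₁ s₂ : ℝ}

instance : AddCommGroup (Sobolev s₁ s₂) :=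
  inferInstanceAs (AddCommGroup (sobolevSubmodule s₁ s₂))

instance : Module ℝ (Sobolev s₁ s₂) :=
  inferInstanceAs (Module ℝ (sobolevSubmodule s₁ s₂))

/-- The tempered distribution underlying an element of `H^{s₁,s₂}`. -/
def toTempered (f : Sobolev s₁ s₂) : Tempered := f.1

/-- The map `f ↦ ⟨D_x⟩ ^ s₁ ⟨D_y⟩ ^ s₂ f` from `H^{s₁,s₂}` to `L²`. -/
def toL2 (s₁ s₂ : ℝ) : Sobolev s₁ s₂ →ₗ[ℝ] L2 where
  toFun f := f.2.2.choose
  map_add' f g := by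
    apply coe_L2_injective
    have hf := f.2.2.choose_spec
    have hg := g.2.2.choose_spec
    have hfg := (f + g).2.2.choose_spec
    rw [map_add, Lp.toTemperedDistributionCLM_apply, Lp.toTemperedDistributionCLM_apply,
      Lp.toTemperedDistributionCLM_apply, ← hf, ← hg, ← hfg, ← map_add]
    rfl
  map_smul' c f := by
    apply coe_L2_injective
    have hf := f.2.2.choose_spec
    have hcf := (c • f).2.2.choose_spec
    have e : ((c • f : Sobolev s₁ s₂).1 : Tempered) = (c : ℂ) • f.1 := by
      change c • f.1 = _
      ext ψ; simp
    have e' : c • f.2.2.choose = (c : ℂ) • f.2.2.choose := by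
      exact (Complex.coe_smul c _).symm
    rw [RingHom.id_apply, e', map_smul, Lp.toTemperedDistributionCLM_apply,
      Lp.toTemperedDistributionCLM_apply, ← hf, ← hcf, e, map_smul]

theorem toL2_spec (f : Sobolev s₁ s₂) :
    bessel s₁ s₂ f.toTempered = (toL2 s₁ s₂ f : L2) :=
  f.2.2.choose_spec

theorem toL2_injective : Function.Injective (toL2 s₁ s₂) := by
  intro f g h
  apply Subtype.ext
  have hf := toL2_spec f
  have hg := toL2_spec g
  rw [h, ← hg] at hf
  have := congrArg (bessel (-s₁) (-s₂)) hf
  rwa [bessel_neg_bessel, bessel_neg_bessel] at this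

/-- The norm of `f ∈ H^{s₁,s₂}` is the `L²` norm of `⟨D_x⟩ ^ s₁ ⟨D_y⟩ ^ s₂ f`, that is, up to the
constant of Plancherel's theorem, the `L²` norm of `⟨ξ⟩ ^ s₁ ⟨η⟩ ^ s₂` times the Fourier transform
of `f`. -/
instance : NormedAddCommGroup (Sobolev s₁ s₂) :=
  NormedAddCommGroup.induced (Sobolev s₁ s₂) L2 (toL2 s₁ s₂) toL2_injective

instance : NormedSpace ℝ (Sobolev s₁ s₂) :=
  NormedSpace.induced ℝ (Sobolev s₁ s₂) L2 (toL2 s₁ s₂)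

theorem norm_def (f : Sobolev s₁ s₂) : ‖f‖ = ‖toL2 s₁ s₂ f‖ := rfl

end Sobolev

/-- The norm of `E^σ(ℝ³)` (up to the constant of Plancherel's theorem), with values in `[0, ∞]`: the
`L²` norm of `⟨ξ⟩ ^ σ (1 + |η| / |ξ|)` times the Fourier transform. -/
def energyNorm (σ : ℝ) (f : L2) : ENNReal :=
  eLpNorm (fun k : Space =>
    (((1 + xi k ^ 2) ^ (σ / 2) * (1 + √(etaSq k) / |xi k|) : ℝ) : ℂ) * (𝓕 f : L2) k) 2 volume

/-- Membership in `E^∞(ℝ³) = ⋂_{σ ≥ 0} E^σ(ℝ³)`. -/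
def MemEnergyInfty (f : L2) : Prop := ∀ σ : ℝ, 0 ≤ σ → energyNorm σ f < ⊤

/-- `v ∈ C([-T, T]; E^∞(ℝ³))`: the curve takes values in every `E^σ` and is continuous for each of
their norms. -/
def ContinuousEnergyInfty (T : ℝ) (v : ℝ → L2) : Prop :=
  (∀ t ∈ Icc (-T) T, MemEnergyInfty (v t)) ∧
    ∀ σ : ℝ, 0 ≤ σ → ∀ t₀ ∈ Icc (-T) T,
      Tendsto (fun t => energyNorm σ (v t - v t₀)) (𝓝[Icc (-T) T] t₀) (𝓝 0)

/-- `v ∈ C([-T, T]; L²)` is a mild solution of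
`∂_t u - ∂_x D_x^α u - ∂_x⁻¹ Δ_y u = ∂_x (u²)` on `[-T, T]`, that is,
`v(t) = S_α(t) v(0) + ∫_0^t S_α(t - t') ∂_x (v(t')²) dt'`, where `S_α(t)` is the unitary group with
Fourier symbol `exp (i t ω_α(ξ, η))`. The formula is written on the Fourier side: for `v(t') ∈ L²` the
square `v(t')²` is integrable, so that its Fourier transform is a continuous function, and `∂_x` acts
on it as multiplication by `i ξ`. -/
structure IsMildSolution (α T : ℝ) (v : ℝ → L2) : Prop where
  continuousOn : ContinuousOn v (Icc (-T) T)
  duhamel : ∀ t ∈ Icc (-T) T, ∀ᵐ k : Space,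
    (𝓕 (v t) : L2) k =
      Complex.exp (Complex.I * t * omega α k) * (𝓕 (v 0) : L2) k +
        ∫ t' in (0 : ℝ)..t, Complex.exp (Complex.I * (t - t') * omega α k) *
          (Complex.I * xi k * 𝓕 (fun x : Space => (v t' x) ^ 2) k)

/-- `Γ`, which maps `H^{s₁,s₂}(ℝ³)` to `C([-T, T]; H^{s₁,s₂}(ℝ³))`, is a flow map of the
dispersion-generalized KP-I equation on the neighbourhood `U` of zero in `H^{s₁,s₂}(ℝ³)`.

* The zero datum has the zero solution. (No other uniqueness of solutions is asked for.)
* If `s₁, s₂ ≥ 0`, so that `H^{s₁,s₂} ⊆ L²`, then for every datum `φ ∈ U` the curve `Γ φ` is a mild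
  solution with initial value `φ`.
* If `s₁ < 0` or `s₂ < 0`, the square of a general element of `H^{s₁,s₂}` has no meaning, and the flow
  map is a map which extends the flow of regular solutions: for every `φ ∈ U ∩ E^∞`, the curve `Γ φ`
  lies in `C([-T, T]; E^∞)` and is a mild solution with initial value `φ`.

Values of `Γ` outside `U` are irrelevant. -/
structure IsFlowMap (α s₁ s₂ T : ℝ) (U : Set (Sobolev s₁ s₂))
    (Γ : Sobolev s₁ s₂ → C(Icc (-T) T, Sobolev s₁ s₂)) : Prop where
  nhds_zero : U ∈ 𝓝 (0 : Sobolev s₁ s₂)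
  map_zero : Γ 0 = 0
  mild : 0 ≤ s₁ → 0 ≤ s₂ → ∀ φ ∈ U, ∃ v : ℝ → L2,
    IsMildSolution α T v ∧ φ.toTempered = (v 0 : L2) ∧
      ∀ t : Icc (-T) T, (Γ φ t).toTempered = (v t : L2)
  regular : s₁ < 0 ∨ s₂ < 0 → ∀ φ ∈ U, ∀ f : L2, φ.toTempered = f → MemEnergyInfty f →
    ∃ v : ℝ → L2, IsMildSolution α T v ∧ ContinuousEnergyInfty T v ∧ v 0 = f ∧
      ∀ t : Icc (-T) T, (Γ φ t).toTempered = (v t : L2)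

end KPI

end

open MeasureTheory Set Filter Topology FourierTransform
open scoped SchwartzMap ComplexConjugate ContDiff

noncomputable section

namespace KPI

/-! If `Γ` is C² at the origin and `Γ 0 = 0`, then `Γ(hφ) + Γ(-hφ)` has norm at most `2 K h² ‖φ‖²`
for small `h`. Divided by `2h²`, its Fourier transform converges pointwise to the second Picard
iterate, that is, the Duhamel integral of the free evolution. Fatou's lemma then bounds this iterate
in `H^{s₁,s₂}` by `K ‖φ‖²` for smooth data (`IsFlowMap.exists_secondIterate_le`). The theorem
follows because no such bound holds (`exists_large_secondIterate`).

Identifying the limit requires `v_h(s)/h → S_α(s) f` in `L²`, where `v_h` is the solution with datum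
`hf`. At each fixed frequency this is cheap: the transform of `v²` is bounded by `‖v‖²`, so the
Duhamel term is `O(h²)` there. Two mechanisms upgrade it to strong convergence. If `s₁, s₂ ≥ 0`,
differentiability of `Γ` gives a limit in a space that controls `L²`
(`tendsto_freeEvolution_of_differentiable`). Otherwise the Sobolev norm does not control `L²`, and
conservation of the `L²` norm by regular real solutions (`norm_eq_of_regular`) is used instead:
pointwise convergence together with equality of norms gives strong convergence.

The counterexample is a high-low interaction. One frequency box sits at `(N, MN, 0)` with side
scales `γ, γ₁, γ₂`, the other near the origin with `ξ ∼ γ`. The resonance function has longitudinal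
part about `-(α+1) N^α ξ₂` and transverse part about `ξ₂ M²`; in KP-I these have opposite signs, and
`M² = (α+1) N^α` cancels them. The boxes are as large as a bounded remainder permits
(`exists_resonant_boxes`). For a short time the interaction is then coherent, and the ratio of the
iterate to the squared norm of the datum is at least a constant times `N (γγ₁γ₂)^{1/2}`. The weights
do not affect this: they vary by a bounded factor over each box and are divided out of the datum. -/

/-! ### Square integrable functions and the Fourier transform of their products -/

theorem memLp_coe (f : L2) : MemLp (fun x => f x) 2 (volume : Measure Space) := Lp.memLp f

theorem integrable_mul_coe (f g : L2) : Integrable (fun x => f x * g x) :=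
  (memLp_coe f).integrable_mul (memLp_coe g)

theorem norm_sq_eq_integral (u : L2) : ‖u‖ ^ 2 = ∫ x, ‖u x‖ ^ 2 := by
  have h := inner_self_eq_norm_sq_to_K (𝕜 := ℂ) u
  rw [L2.inner_def] at h
  simp_rw [inner_self_eq_norm_sq_to_K] at h
  have h2 : ∫ x, ((‖u x‖ ^ 2 : ℝ) : ℂ) = ((‖u‖ ^ 2 : ℝ) : ℂ) := by
    simpa using h
  rw [integral_complex_ofReal] at h2
  exact_mod_cast h2.symm

theorem integral_norm_mul_le (f g : L2) : ∫ x, ‖f x‖ * ‖g x‖ ≤ ‖f‖ * ‖g‖ := by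
  have h := integral_mul_le_Lp_mul_Lq_of_nonneg (μ := (volume : Measure Space))
    Real.HolderConjugate.two_two
    (f := fun x => ‖f x‖) (g := fun x => ‖g x‖) (ae_of_all _ fun _ => norm_nonneg _)
    (ae_of_all _ fun _ => norm_nonneg _) (by simpa using (memLp_coe f).norm)
    (by simpa using (memLp_coe g).norm)
  refine h.trans (le_of_eq ?_)
  have e (u : L2) : (∫ x, ‖u x‖ ^ (2 : ℝ)) ^ (1 / (2 : ℝ)) = ‖u‖ := by
    have h1 : ∫ x, ‖u x‖ ^ (2 : ℝ) = ‖u‖ ^ 2 := by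
      rw [norm_sq_eq_integral]
      simp
    rw [h1, ← Real.sqrt_eq_rpow, Real.sqrt_sq (norm_nonneg _)]
  rw [e, e]

theorem continuous_integral_mul {u : Space → ℂ} (hu : MemLp u 2 volume) :
    Continuous fun f : L2 => ∫ x, f x * u x := by
  have hu' : MemLp (fun x => conj (u x)) 2 volume := hu.star
  have : (fun f : L2 => ∫ x, f x * u x) = fun f : L2 => inner ℂ (hu'.toLp _) f := by
    ext f
    rw [L2.inner_def]
    apply integral_congr_ae
    filter_upwards [hu'.coeFn_toLp] with x hx
    simp [hx]
  rw [this]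
  fun_prop

theorem integral_fourier_mul_schwartz (f : L2) (ψ : 𝓢(Space, ℂ)) :
    ∫ k, (𝓕 f : L2) k * ψ k = ∫ x, f x * (𝓕 ψ) x := by
  have h := DFunLike.congr_fun (Lp.fourier_toTemperedDistribution_eq f) ψ
  rw [TemperedDistribution.fourier_apply, Lp.toTemperedDistribution_apply,
    Lp.toTemperedDistribution_apply] at h
  simp only [smul_eq_mul] at h
  simp_rw [mul_comm _ (ψ _), mul_comm _ ((𝓕 ψ) _)]
  exact h.symm

/-- The Fourier transform of the product of two square integrable functions. -/
theorem fourier_mul_schwartz (f : L2) (h : 𝓢(Space, ℂ)) (k : Space) :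
    𝓕 (fun x => f x * (𝓕⁻ h) x) k = ∫ l, (𝓕 f : L2) l * h (k - l) := by
  let ψ : 𝓢(Space, ℂ) := (SchwartzMap.compCLMOfContinuousLinearEquiv ℂ
    (LinearIsometryEquiv.neg ℝ (E := Space)).toContinuousLinearEquiv h).compSubConstCLM ℂ k
  have hψ (l : Space) : ψ l = h (k - l) := by
    simp [ψ]
  simp_rw [← hψ]
  rw [integral_fourier_mul_schwartz, Real.fourier_eq]
  congr 1
  ext x
  have : (𝓕 ψ) x = Real.fourierChar (-(inner ℝ x k)) • (𝓕⁻ h) x := by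
    rw [SchwartzMap.fourier_coe, SchwartzMap.fourierInv_coe, Real.fourier_eq, Real.fourierInv_eq,
      ← integral_sub_left_eq_self _ volume k, Circle.smul_def, ← integral_smul]
    congr 1
    ext l
    rw [hψ, sub_sub_cancel, ← Circle.smul_def, smul_smul, ← AddChar.map_add_eq_mul,
      inner_sub_left, real_inner_comm k x]
    congr 2
    ring
  rw [this]
  simp only [Circle.smul_def, smul_eq_mul]
  ring

/-- For fixed `f` and `k` both sides are `L²` pairings, hence continuous in the transform of `g`, so
density reduces the claim to a Schwartz function. There it is the definition of the distributional
Fourier transform, tested on a reflected translate. -/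
theorem fourier_mul_eq_convolution (f g : L2) (k : Space) :
    𝓕 (fun x => f x * g x) k = ∫ l, (𝓕 f : L2) l * (𝓕 g : L2) (k - l) := by
  have key (g' : L2) : 𝓕 (fun x => f x * (𝓕⁻ g' : L2) x) k
      = ∫ l, (𝓕 f : L2) l * g' (k - l) := by
    refine DenseRange.induction_on (p := fun g' : L2 => 𝓕 (fun x => f x * (𝓕⁻ g' : L2) x) k
      = ∫ l, (𝓕 f : L2) l * g' (k - l))
      (SchwartzMap.denseRange_toLpCLM (p := 2) ENNReal.ofNat_ne_top) g' ?_ ?_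
    · apply isClosed_eq
      · have hu : MemLp (fun x => Real.fourierChar (-(inner ℝ x k)) • f x) 2 volume := by
          refine (memLp_coe f).of_le ?_ (ae_of_all _ fun x => by simp)
          refine AEStronglyMeasurable.smul ?_ (memLp_coe f).1
          fun_prop
        have := (continuous_integral_mul hu).comp
          (continuous_fourierInv : Continuous fun f : L2 => (𝓕⁻ f : L2))
        convert! this using 2 with g
        rw [Real.fourier_eq]
        congr 1
        ext x
        simp only [Circle.smul_def, smul_eq_mul]
        ring
      · have hu : MemLp (fun l => (𝓕 f : L2) (k - l)) 2 volume :=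
          (memLp_coe (𝓕 f)).comp_measurePreserving (Measure.measurePreserving_sub_left volume k)
        convert! continuous_integral_mul hu using 2 with g
        rw [← integral_sub_left_eq_self _ volume k]
        congr 1
        ext l
        rw [sub_sub_cancel, mul_comm]
    · intro h
      simp only [SchwartzMap.toLpCLM_apply, SchwartzMap.toLp_fourierInv_eq]
      have e1 := (h.coeFn_toLp 2 (volume : Measure Space))
      have e2 := ((𝓕⁻ h).coeFn_toLp 2 (volume : Measure Space))
      rw [show (∫ l, (𝓕 f : L2) l * (h.toLp 2 volume : L2) (k - l))
        = ∫ l, (𝓕 f : L2) l * h (k - l) from ?_, ← fourier_mul_schwartz, Real.fourier_eq,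
        Real.fourier_eq]
      · apply integral_congr_ae
        filter_upwards [e2] with x hx
        rw [hx]
      · apply integral_congr_ae
        filter_upwards [(Measure.measurePreserving_sub_left volume k).quasiMeasurePreserving.ae e1] with l hl
        change (h.toLp 2 volume : L2) (k - l) = h (k - l) at hl
        rw [hl]
  have := key (𝓕 g)
  rwa [fourierInv_fourier_eq] at this


/-- The Fourier transform of the square of a square integrable function. -/
def fourierSq (f : L2) (k : Space) : ℂ := 𝓕 (fun x : Space => (f x) ^ 2) k

theorem fourierSq_eq_convolution (f : L2) (k : Space) :
    fourierSq f k = ∫ l, (𝓕 f : L2) l * (𝓕 f : L2) (k - l) := by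
  rw [← fourier_mul_eq_convolution, fourierSq]
  simp_rw [sq]

theorem integrable_sq_coe (f : L2) : Integrable (fun x => (f x) ^ 2) := by
  simp_rw [sq]
  exact integrable_mul_coe f f

theorem continuous_fourierSq (f : L2) : Continuous (fourierSq f) :=
  VectorFourier.fourierIntegral_continuous Real.continuous_fourierChar
    (L := innerₗ Space) continuous_inner (integrable_sq_coe f)

/-- From `f² - g² = (f - g)(f + g)` and Cauchy–Schwarz in `L¹`. Uniformity in `k` is what makes
`fourierSq` jointly continuous. -/
theorem norm_fourierSq_sub_le (f g : L2) (k : Space) :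
    ‖fourierSq f k - fourierSq g k‖ ≤ ‖f - g‖ * ‖f + g‖ := by
  have hint (u : L2) : Integrable fun x => Real.fourierChar (-(inner ℝ x k)) • (u x) ^ 2 :=
    (Real.fourierIntegral_convergent_iff k).2 (integrable_sq_coe u)
  rw [fourierSq, fourierSq, Real.fourier_eq, Real.fourier_eq, ← integral_sub (hint f) (hint g)]
  refine (norm_integral_le_integral_norm _).trans ((le_of_eq ?_).trans
    (integral_norm_mul_le (f - g) (f + g)))
  apply integral_congr_ae
  filter_upwards [Lp.coeFn_sub f g, Lp.coeFn_add f g] with x h1 h2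
  rw [h1, h2, ← smul_sub, Circle.norm_smul, ← norm_mul]
  simp only [Pi.sub_apply, Pi.add_apply]
  congr 1
  ring

theorem fourierSq_zero (k : Space) : fourierSq 0 k = 0 := by
  rw [fourierSq, Real.fourier_eq, integral_eq_zero_of_ae]
  filter_upwards [Lp.coeFn_zero ℂ 2 (volume : Measure Space)] with x hx
  rw [hx]
  simp

theorem norm_fourierSq_le (f : L2) (k : Space) : ‖fourierSq f k‖ ≤ ‖f‖ ^ 2 := by
  have := norm_fourierSq_sub_le f 0 k
  rw [fourierSq_zero, sub_zero, sub_zero, add_zero] at this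
  rwa [sq]

theorem fourierSq_smul (c : ℂ) (f : L2) (k : Space) :
    fourierSq (c • f) k = c ^ 2 * fourierSq f k := by
  rw [fourierSq, fourierSq, Real.fourier_eq, Real.fourier_eq, ← integral_const_mul]
  apply integral_congr_ae
  filter_upwards [Lp.coeFn_smul c f] with x hx
  rw [hx]
  simp only [Pi.smul_apply, smul_eq_mul, Circle.smul_def]
  ring

theorem continuous_fourierSq_uncurry : Continuous fun p : L2 × Space => fourierSq p.1 p.2 := by
  rw [continuous_iff_continuousAt]
  rintro ⟨f, k⟩
  rw [ContinuousAt, tendsto_iff_norm_sub_tendsto_zero]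
  have h1 : Tendsto (fun p : L2 × Space => ‖p.1 - f‖ * ‖p.1 + f‖
      + ‖fourierSq f p.2 - fourierSq f k‖) (𝓝 (f, k)) (𝓝 0) := by
    have hc : Continuous fun p : L2 × Space => ‖p.1 - f‖ * ‖p.1 + f‖
      + ‖fourierSq f p.2 - fourierSq f k‖ := by
      have := (continuous_fourierSq f).comp (continuous_snd (X := L2))
      simp only [Function.comp_def] at this
      fun_prop
    simpa using hc.tendsto (f, k)
  refine squeeze_zero (fun _ => norm_nonneg _) (fun p => ?_) h1
  have := norm_fourierSq_sub_le p.1 f p.2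
  calc ‖fourierSq p.1 p.2 - fourierSq f k‖ = ‖(fourierSq p.1 p.2 - fourierSq f p.2)
        + (fourierSq f p.2 - fourierSq f k)‖ := by congr 1; ring
    _ ≤ _ := (norm_add_le _ _).trans (by gcongr)

/-! ### Real-valued distributions -/

/-- The complex conjugate of a Schwartz function. -/
def conjSchwartz (ψ : 𝓢(Space, ℂ)) : 𝓢(Space, ℂ) :=
  ψ.postcompCLM (Complex.conjCLE : ℂ →L[ℝ] ℂ)

theorem conjSchwartz_apply (ψ : 𝓢(Space, ℂ)) (x : Space) : conjSchwartz ψ x = conj (ψ x) := rfl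

/-- The reflection of a Schwartz function. -/
def reflSchwartz (ψ : 𝓢(Space, ℂ)) : 𝓢(Space, ℂ) :=
  SchwartzMap.compCLMOfContinuousLinearEquiv ℂ
    (LinearIsometryEquiv.neg ℝ (E := Space)).toContinuousLinearEquiv ψ

theorem reflSchwartz_apply (ψ : 𝓢(Space, ℂ)) (x : Space) : reflSchwartz ψ x = ψ (-x) := rfl

theorem fourier_conj_refl (ψ : 𝓢(Space, ℂ)) :
    𝓕 (conjSchwartz (reflSchwartz ψ)) = conjSchwartz (𝓕 ψ) := by
  ext x
  rw [conjSchwartz_apply, SchwartzMap.fourier_coe, SchwartzMap.fourier_coe, Real.fourier_eq,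
    Real.fourier_eq, ← integral_conj, ← integral_neg_eq_self]
  congr 1
  ext l
  rw [conjSchwartz_apply, reflSchwartz_apply, neg_neg]
  simp only [Circle.smul_def, smul_eq_mul, map_mul]
  rw [← Circle.coe_inv_eq_conj, ← AddChar.map_neg_eq_inv]
  simp

theorem isRealValued_iff (f : Tempered) :
    IsRealValued f ↔ ∀ ψ, f (conjSchwartz ψ) = conj (f ψ) := by
  constructor
  · intro h ψ
    -- The two real test functions `ψ + ψ̄` and `i(ψ - ψ̄)` determine the conjugation behaviour on
    -- `ψ`.
    have hr := h (ψ + conjSchwartz ψ) fun x => by simp [conjSchwartz_apply]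
    have hi := h (Complex.I • (ψ - conjSchwartz ψ)) fun x => by simp [conjSchwartz_apply]
    simp only [map_add, map_smul, map_sub, Complex.add_im, smul_eq_mul, Complex.mul_im,
      Complex.I_re, Complex.I_im, Complex.sub_re, Complex.sub_im] at hr hi
    apply Complex.ext
    · rw [Complex.conj_re]; linarith
    · rw [Complex.conj_im]; linarith
  · intro h ψ hψ
    have : conjSchwartz ψ = ψ := by
      ext x
      rw [conjSchwartz_apply, Complex.conj_eq_iff_im, hψ]
    have h2 := h ψ
    rw [this] at h2
    exact Complex.conj_eq_iff_im.1 h2.symm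

theorem L2_apply_schwartz (f : L2) (ψ : 𝓢(Space, ℂ)) :
    (f : Tempered) ψ = ∫ x, f x * ψ x := by
  rw [Lp.toTemperedDistribution_apply]
  simp_rw [smul_eq_mul, mul_comm]

theorem ae_eq_of_integral_schwartz {f g : Space → ℂ} (hf : LocallyIntegrable f)
    (hg : LocallyIntegrable g)
    (h : ∀ ψ : 𝓢(Space, ℂ), HasCompactSupport ψ → ∫ x, f x * ψ x = ∫ x, g x * ψ x) :
    f =ᵐ[volume] g := by
  apply ae_eq_of_integral_contDiff_smul_eq hf hg
  intro u u_smooth u_cpt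
  have hu₁ : HasCompactSupport (Complex.ofRealCLM ∘ u) := u_cpt.comp_left rfl
  have hu₂ : ContDiff ℝ ∞ (Complex.ofRealCLM ∘ u) := by fun_prop
  have := h (hu₁.toSchwartzMap hu₂) hu₁
  simpa [mul_comm] using this

theorem locallyIntegrable_coe (f : L2) : LocallyIntegrable (fun x => f x) :=
  (memLp_coe f).locallyIntegrable (by norm_num)

theorem integral_fourier_neg_conj (f : L2) (ψ : 𝓢(Space, ℂ)) :
    ∫ k, conj ((𝓕 f : L2) (-k)) * ψ k = conj ((f : Tempered) (conjSchwartz (𝓕 ψ))) := by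
  rw [← fourier_conj_refl, L2_apply_schwartz, ← integral_fourier_mul_schwartz, ← integral_conj,
    ← integral_neg_eq_self]
  congr 1
  ext k
  rw [neg_neg, map_mul, conjSchwartz_apply, reflSchwartz_apply]
  simp

theorem locallyIntegrable_conj_neg (f : L2) : LocallyIntegrable (fun k => conj (f (-k))) :=
  MemLp.locallyIntegrable
    (((memLp_coe f).comp_measurePreserving (Measure.measurePreserving_neg volume)).star)
    (by norm_num : (1 : ENNReal) ≤ 2)

/-- Hermitian symmetry of the transform is the form in which reality enters the conservation law;
the converse below makes the counterexample data real. -/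
theorem fourier_neg_of_isRealValued {f : L2} (h : IsRealValued (f : Tempered)) :
    ∀ᵐ k, (𝓕 f : L2) (-k) = conj ((𝓕 f : L2) k) := by
  have : (fun k => conj ((𝓕 f : L2) (-k))) =ᵐ[volume] fun k => (𝓕 f : L2) k := by
    apply ae_eq_of_integral_schwartz (locallyIntegrable_conj_neg _) (locallyIntegrable_coe _)
    intro ψ _
    rw [integral_fourier_neg_conj, (isRealValued_iff _).1 h, Complex.conj_conj,
      integral_fourier_mul_schwartz, L2_apply_schwartz]
  filter_upwards [this] with k hk
  rw [← hk, Complex.conj_conj]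

theorem isRealValued_of_fourier_neg {f : L2}
    (h : ∀ᵐ k, (𝓕 f : L2) (-k) = conj ((𝓕 f : L2) k)) : IsRealValued (f : Tempered) := by
  rw [isRealValued_iff]
  intro ψ
  obtain ⟨ψ, rfl⟩ : ∃ ψ', 𝓕 ψ' = ψ := ⟨𝓕⁻ ψ, fourier_fourierInv_eq ψ⟩
  have h1 := integral_fourier_neg_conj f ψ
  rw [← Complex.conj_conj ((f : Tempered) (conjSchwartz (𝓕 ψ))), ← h1, L2_apply_schwartz,
    ← integral_fourier_mul_schwartz]
  congr 1
  apply integral_congr_ae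
  filter_upwards [h] with k hk
  rw [hk, Complex.conj_conj]

/-! ### The Fourier transform of an element of the Sobolev space -/

theorem continuous_xi : Continuous xi := by
  unfold xi; fun_prop

theorem continuous_etaSq : Continuous etaSq := by
  unfold etaSq; fun_prop

theorem etaSq_nonneg (k : Space) : 0 ≤ etaSq k := by
  unfold etaSq; positivity

theorem weight_pos (s₁ s₂ : ℝ) (k : Space) : 0 < weight s₁ s₂ k := by
  have := etaSq_nonneg k
  unfold weight; positivity

theorem continuous_weight (s₁ s₂ : ℝ) : Continuous (weight s₁ s₂) := by
  unfold weight
  refine Continuous.mul (Continuous.rpow_const ?_ fun k => ?_)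
    (Continuous.rpow_const ?_ fun k => ?_)
  · have := continuous_xi; fun_prop
  · left; positivity
  · have := continuous_etaSq; fun_prop
  · left; have := etaSq_nonneg k; positivity

theorem weight_neg_arg (s₁ s₂ : ℝ) (k : Space) : weight s₁ s₂ (-k) = weight s₁ s₂ k := by
  simp [weight, xi, etaSq]

theorem locallyIntegrable_weight_mul (s₁ s₂ : ℝ) (f : L2) :
    LocallyIntegrable (fun k => (weight s₁ s₂ k : ℂ) * f k) := by
  have hc : Continuous fun k => (weight s₁ s₂ k : ℂ) := by
    have := continuous_weight s₁ s₂; fun_prop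
  have h := locallyIntegrable_coe f
  rw [← locallyIntegrableOn_univ] at h ⊢
  exact h.continuousOn_mul hc.continuousOn isOpen_univ.isLocallyClosed

/-- Every Schwartz function is a Fourier transform, so it suffices to test on `𝓕 ψ`, where the
multiplier becomes multiplication by the weight. Sobolev norms thereby turn into weighted `L²` norms
of the transform. -/
theorem bessel_coe_eq_coe_iff (s₁ s₂ : ℝ) (f g : L2) :
    bessel s₁ s₂ (f : Tempered) = (g : Tempered) ↔
      ∀ᵐ k, (𝓕 g : L2) k = weight s₁ s₂ k * (𝓕 f : L2) k := by
  have key (ψ : 𝓢(Space, ℂ)) : bessel s₁ s₂ (f : Tempered) (𝓕 ψ)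
      = ∫ k, (weight s₁ s₂ k * (𝓕 f : L2) k) * ψ k := by
    rw [bessel, TemperedDistribution.fourierMultiplierCLM_apply_apply, fourierInv_fourier_eq,
      L2_apply_schwartz, ← integral_fourier_mul_schwartz]
    congr 1
    ext k
    rw [SchwartzMap.smulLeftCLM_apply_apply (weight_hasTemperateGrowth s₁ s₂), smul_eq_mul]
    ring
  have key2 (ψ : 𝓢(Space, ℂ)) : (g : Tempered) (𝓕 ψ) = ∫ k, (𝓕 g : L2) k * ψ k := by
    rw [L2_apply_schwartz, ← integral_fourier_mul_schwartz]
  constructor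
  · intro h
    apply ae_eq_of_integral_schwartz (locallyIntegrable_coe _) (locallyIntegrable_weight_mul _ _ _)
    intro ψ _
    rw [← key, h, key2]
  · intro h
    ext ψ
    obtain ⟨ψ, rfl⟩ : ∃ ψ', 𝓕 ψ' = ψ := ⟨𝓕⁻ ψ, fourier_fourierInv_eq ψ⟩
    rw [key, key2]
    apply integral_congr_ae
    filter_upwards [h] with k hk
    rw [hk]

theorem Sobolev.fourier_toL2 {s₁ s₂ : ℝ} (φ : Sobolev s₁ s₂) {f : L2}
    (h : φ.toTempered = (f : Tempered)) :
    ∀ᵐ k, (𝓕 (Sobolev.toL2 s₁ s₂ φ) : L2) k = weight s₁ s₂ k * (𝓕 f : L2) k := by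
  rw [← bessel_coe_eq_coe_iff, ← h]
  exact Sobolev.toL2_spec φ


/-! ### The trilinear form of the conservation law -/

theorem measurable_xi : Measurable xi := continuous_xi.measurable

theorem ae_xi_ne_zero : ∀ᵐ k : Space, xi k ≠ 0 := by
  have h := Measure.addHaar_submodule (volume : Measure Space)
    (LinearMap.ker (EuclideanSpace.proj 0 : Space →L[ℝ] ℝ).toLinearMap) (by
      intro h
      have : EuclideanSpace.single (0 : Fin 3) (1 : ℝ) ∈ LinearMap.ker
        (EuclideanSpace.proj 0 : Space →L[ℝ] ℝ).toLinearMap := by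
        rw [h]; trivial
      simp at this)
  rw [ae_iff]
  refine measure_mono_null (fun k hk => ?_) h
  simp only [ne_eq, not_not, mem_ofPred_eq, xi, mul_eq_zero] at hk
  have : k 0 = 0 := hk.resolve_left (by simp [Real.pi_ne_zero])
  simpa using this

theorem xi_add (k l : Space) : xi (k + l) = xi k + xi l := by
  simp [xi]; ring

theorem xi_neg (k : Space) : xi (-k) = -xi k := by
  simp [xi]

/-- The arithmetic–geometric mean inequality for `xy`, `yz`, `xz`. Each term on the right involves
only two of the three frequencies of the trilinear form. -/
theorem sq_mul_le_sum_cubes {x y z : ℝ} (hx : 0 ≤ x) (hy : 0 ≤ y) (hz : 0 ≤ z) :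
    (x * y * z) ^ 2 ≤ x ^ 3 * y ^ 3 + y ^ 3 * z ^ 3 + x ^ 3 * z ^ 3 := by
  have key {a b c : ℝ} (ha : 0 ≤ a) (hb : 0 ≤ b) (hc : 0 ≤ c) :
      a * b * c ≤ a ^ 3 + b ^ 3 + c ^ 3 := by
    have := mul_nonneg (mul_nonneg ha hb) hc
    nlinarith [mul_nonneg (add_nonneg (add_nonneg ha hb) hc) (sq_nonneg (a - b)),
      mul_nonneg (add_nonneg (add_nonneg ha hb) hc) (sq_nonneg (b - c)),
      mul_nonneg (add_nonneg (add_nonneg ha hb) hc) (sq_nonneg (a - c))]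
  have := key (mul_nonneg hx hy) (mul_nonneg hy hz) (mul_nonneg hx hz)
  calc _ = (x * y) * (y * z) * (x * z) := by ring
    _ ≤ _ := this
    _ = _ := by ring

/-- The square root of `max 1 |ξ| |g|`. -/
def rootDensity (g : Space → ℂ) (k : Space) : ℝ := √(‖g k‖ * max 1 |xi k|)

theorem rootDensity_nonneg (g : Space → ℂ) (k : Space) : 0 ≤ rootDensity g k := Real.sqrt_nonneg _

theorem rootDensity_sq (g : Space → ℂ) (k : Space) :
    rootDensity g k ^ 2 = ‖g k‖ * max 1 |xi k| := Real.sq_sqrt (by positivity)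

theorem norm_le_rootDensity_sq (g : Space → ℂ) (k : Space) : ‖g k‖ ≤ rootDensity g k ^ 2 := by
  rw [rootDensity_sq]
  exact le_mul_of_one_le_right (norm_nonneg _) (le_max_left _ _)

theorem xi_mul_norm_le_rootDensity_sq (g : Space → ℂ) (k : Space) :
    |xi k| * ‖g k‖ ≤ rootDensity g k ^ 2 := by
  rw [rootDensity_sq, mul_comm]
  gcongr
  exact le_max_right _ _

/-- The integral of `(max 1 |ξ| |g|) ^ (3/2)`. -/
def threeHalvesMass (g : Space → ℂ) : ENNReal := ∫⁻ k, ENNReal.ofReal (rootDensity g k ^ 3)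

variable {g : Space → ℂ}

theorem measurable_rootDensity (hg : StronglyMeasurable g) : Measurable (rootDensity g) := by
  have := hg.measurable
  have := measurable_xi
  unfold rootDensity
  fun_prop

/-- An elementary substitute for Young's convolution inequality with all exponents `3/2`: after the
pointwise bound by pairs, a measure-preserving shear turns each of the three terms into a product of
independent integrals. -/
theorem lintegral_rootDensity_trilinear_le (hg : StronglyMeasurable g) :
    ∫⁻ z : Space × Space, ENNReal.ofReal
      ((rootDensity g z.1 * rootDensity g z.2 * rootDensity g (z.1 + z.2)) ^ 2)
      ≤ 3 * threeHalvesMass g ^ 2 := by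
  have hp := measurable_rootDensity hg
  let E : Space × Space → ENNReal := fun z =>
    ENNReal.ofReal (rootDensity g z.1 ^ 3) * ENNReal.ofReal (rootDensity g z.2 ^ 3)
  have hE : Measurable E := by fun_prop
  have hEint : ∫⁻ z, E z = threeHalvesMass g ^ 2 := by
    rw [sq, threeHalvesMass, Measure.volume_eq_prod]
    exact lintegral_prod_mul (hp.pow_const 3).ennreal_ofReal.aemeasurable
      (hp.pow_const 3).ennreal_ofReal.aemeasurable
  have h2 : ∫⁻ z : Space × Space, E (z.2, z.2 + z.1) = threeHalvesMass g ^ 2 := by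
    rw [← hEint]
    exact (measurePreserving_prod_add_swap (volume : Measure Space) volume).lintegral_comp hE
  have h3 : ∫⁻ z : Space × Space, E (z.1, z.1 + z.2) = threeHalvesMass g ^ 2 := by
    rw [← hEint]
    exact (measurePreserving_prod_add (volume : Measure Space) volume).lintegral_comp hE
  calc _ ≤ ∫⁻ z : Space × Space, (E z + E (z.2, z.2 + z.1)) + E (z.1, z.1 + z.2) := by
        refine lintegral_mono fun z => ?_
        have n1 := rootDensity_nonneg g z.1
        have n2 := rootDensity_nonneg g z.2
        have n3 := rootDensity_nonneg g (z.1 + z.2)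
        simp only [E]
        rw [add_comm z.2 z.1, ← ENNReal.ofReal_mul (by positivity),
          ← ENNReal.ofReal_mul (by positivity), ← ENNReal.ofReal_mul (by positivity),
          ← ENNReal.ofReal_add (by positivity) (by positivity),
          ← ENNReal.ofReal_add (by positivity) (by positivity)]
        exact ENNReal.ofReal_le_ofReal (sq_mul_le_sum_cubes n1 n2 n3)
    _ = 3 * threeHalvesMass g ^ 2 := by
        rw [lintegral_add_right _ (by fun_prop), lintegral_add_right _ (by fun_prop), hEint, h2,
          h3]
        ring

theorem lintegral_trilinear_le (hg : StronglyMeasurable g) {h : Space × Space → ℂ}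
    (hh : ∀ z, ‖h z‖ ≤ (rootDensity g z.1 * rootDensity g z.2 * rootDensity g (z.1 + z.2)) ^ 2) :
    ∫⁻ z, ‖h z‖ₑ ≤ 3 * threeHalvesMass g ^ 2 := by
  refine le_trans (lintegral_mono fun z => ?_) (lintegral_rootDensity_trilinear_le hg)
  rw [← ofReal_norm]
  exact ENNReal.ofReal_le_ofReal (hh z)

theorem norm_trilinear_le (k l : Space) :
    ‖(xi (k + l) : ℂ) * conj (g (k + l)) * (g l * g k)‖ ≤
      (rootDensity g k * rootDensity g l * rootDensity g (k + l)) ^ 2 := by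
  have h1 := norm_le_rootDensity_sq g k
  have h2 := norm_le_rootDensity_sq g l
  have h3 := xi_mul_norm_le_rootDensity_sq g (k + l)
  rw [norm_mul, norm_mul, norm_mul, Complex.norm_real, Real.norm_eq_abs, RCLike.norm_conj]
  calc _ ≤ rootDensity g (k + l) ^ 2 * (rootDensity g l ^ 2 * rootDensity g k ^ 2) := by gcongr
    _ = _ := by ring

theorem norm_trilinear_left_le (k l : Space) :
    ‖(xi k : ℂ) * conj (g (k + l)) * (g l * g k)‖ ≤
      (rootDensity g k * rootDensity g l * rootDensity g (k + l)) ^ 2 := by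
  have h1 := xi_mul_norm_le_rootDensity_sq g k
  have h2 := norm_le_rootDensity_sq g l
  have h3 := norm_le_rootDensity_sq g (k + l)
  rw [norm_mul, norm_mul, norm_mul, Complex.norm_real, Real.norm_eq_abs, RCLike.norm_conj]
  calc _ = ‖g (k + l)‖ * (‖g l‖ * (|xi k| * ‖g k‖)) := by ring
    _ ≤ rootDensity g (k + l) ^ 2 * (rootDensity g l ^ 2 * rootDensity g k ^ 2) := by gcongr
    _ = _ := by ring

theorem lintegral_trilinear_convolution_le (hg : StronglyMeasurable g) :
    ∫⁻ k, ‖(xi k : ℂ) * conj (g k) * ∫ l, g l * g (k - l)‖ₑ ≤ 3 * threeHalvesMass g ^ 2 := by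
  have hm := hg.measurable
  have hx := measurable_xi
  calc _ ≤ ∫⁻ k, ∫⁻ l, ‖(xi k : ℂ) * conj (g k) * (g l * g (k - l))‖ₑ := by
        refine lintegral_mono fun k => ?_
        rw [← integral_const_mul]
        exact enorm_integral_le_lintegral_enorm _
    _ = ∫⁻ z : Space × Space, ‖(xi z.1 : ℂ) * conj (g z.1) * (g z.2 * g (z.1 - z.2))‖ₑ := by
        have : Measurable fun z : Space × Space =>
          ‖(xi z.1 : ℂ) * conj (g z.1) * (g z.2 * g (z.1 - z.2))‖ₑ := by
          refine Measurable.enorm (Measurable.mul (Measurable.mul ?_ ?_) ?_)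
          · fun_prop
          · exact Complex.continuous_conj.measurable.comp (by fun_prop)
          · fun_prop
        rw [Measure.volume_eq_prod, lintegral_prod _ this.aemeasurable]
    _ = ∫⁻ z : Space × Space,
          ‖(xi (z.1 + z.2) : ℂ) * conj (g (z.1 + z.2)) * (g z.2 * g z.1)‖ₑ := by
        have : Measurable fun z : Space × Space =>
          ‖(xi (z.1 + z.2) : ℂ) * conj (g (z.1 + z.2)) * (g z.2 * g z.1)‖ₑ := by
          refine Measurable.enorm (Measurable.mul (Measurable.mul ?_ ?_) ?_)
          · fun_prop
          · exact Complex.continuous_conj.measurable.comp (by fun_prop)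
          · fun_prop
        rw [Measure.volume_eq_prod,
          ← (measurePreserving_sub_prod (volume : Measure Space) volume).lintegral_comp this]
        simp
    _ ≤ _ := lintegral_trilinear_le hg fun z => norm_trilinear_le z.1 z.2

/-- Let `I` and `J` be the integrals of `ξ(k+l) Φ` and `ξ(k) Φ`. Exchanging `k` and `l` gives `I =
2J`. The substitution `(k, l) ↦ (-(k+l), l)` and Hermitian symmetry give `J = -I`. Hence `I = 0`.
The finite mass provides the absolute convergence that justifies splitting and Fubini. -/
theorem integral_trilinear_convolution_eq_zero (hg : StronglyMeasurable g)
    (hfin : threeHalvesMass g < ⊤) (hsymm : ∀ᵐ k, g (-k) = conj (g k)) :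
    ∫ k, (xi k : ℂ) * conj (g k) * ∫ l, g l * g (k - l) = 0 := by
  have hm := hg.measurable
  have hx := measurable_xi
  have htop : (3 * threeHalvesMass g ^ 2 : ENNReal) < ⊤ :=
    ENNReal.mul_lt_top (by norm_num) (ENNReal.pow_lt_top hfin)
  let Φ : Space × Space → ℂ := fun z => conj (g (z.1 + z.2)) * (g z.2 * g z.1)
  have hΦ : Measurable Φ := by fun_prop
  have i1 : Integrable fun z : Space × Space => (xi (z.1 + z.2) : ℂ) * Φ z := by
    refine ⟨by fun_prop, (lintegral_trilinear_le hg fun z => ?_).trans_lt htop⟩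
    rw [← mul_assoc]
    exact norm_trilinear_le z.1 z.2
  have i2 : Integrable fun z : Space × Space => (xi z.1 : ℂ) * Φ z := by
    refine ⟨by fun_prop, (lintegral_trilinear_le hg fun z => ?_).trans_lt htop⟩
    rw [← mul_assoc]
    exact norm_trilinear_left_le z.1 z.2
  have comp {T : Space × Space → Space × Space} (hT : MeasurePreserving T volume volume)
      {h : Space × Space → ℂ} (hh : Measurable h) : ∫ z, h (T z) = ∫ z, h z := by
    rw [← integral_map hT.measurable.aemeasurable hh.aestronglyMeasurable, hT.map_eq]
  have hswap : MeasurePreserving (Prod.swap : Space × Space → _) volume volume :=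
    Measure.measurePreserving_swap
  have hΦs (z : Space × Space) : Φ z.swap = Φ z := by
    simp only [Φ, Prod.fst_swap, Prod.snd_swap]
    rw [add_comm z.2 z.1, mul_comm (g z.1)]
  have i3 : Integrable fun z : Space × Space => (xi z.2 : ℂ) * Φ z := by
    convert! hswap.integrable_comp_of_integrable i2 using 2 with z
    simp [Function.comp, hΦs]
  have e1 : ∫ z : Space × Space, (xi (z.1 + z.2) : ℂ) * Φ z
      = 2 * ∫ z : Space × Space, (xi z.1 : ℂ) * Φ z := by
    have e3 : ∫ z : Space × Space, (xi z.2 : ℂ) * Φ z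
        = ∫ z : Space × Space, (xi z.1 : ℂ) * Φ z := by
      rw [← comp hswap (h := fun z : Space × Space => (xi z.1 : ℂ) * Φ z) (by fun_prop)]
      simp [hΦs]
    simp_rw [xi_add, Complex.ofReal_add, add_mul]
    rw [integral_add i2 i3, e3]
    ring
  have e2 : ∫ z : Space × Space, (xi z.1 : ℂ) * Φ z
      = -∫ z : Space × Space, (xi (z.1 + z.2) : ℂ) * Φ z := by
    have hT1 := measurePreserving_add_prod (volume : Measure Space) (volume : Measure Space)
    have hT : MeasurePreserving (fun z : Space × Space => (-(z.1 + z.2), z.2)) volume volume :=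
      ((Measure.measurePreserving_neg (volume : Measure Space)).prod
        (MeasurePreserving.id (volume : Measure Space))).comp hT1
    rw [← comp hT (h := fun z : Space × Space => (xi z.1 : ℂ) * Φ z) (by fun_prop),
      ← integral_neg]
    apply integral_congr_ae
    have a1 : ∀ᵐ z : Space × Space, g (-z.1) = conj (g z.1) :=
      Measure.quasiMeasurePreserving_fst.ae hsymm
    have a2 : ∀ᵐ z : Space × Space, g (-(z.1 + z.2)) = conj (g (z.1 + z.2)) :=
      hT1.quasiMeasurePreserving.ae a1
    filter_upwards [a1, a2] with z h1 h2
    have : -(z.1 + z.2) + z.2 = -z.1 := by abel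
    simp only [Φ, this, h1, h2, xi_neg, Complex.conj_conj, Complex.ofReal_neg]
    ring
  have e0 : ∫ k, (xi k : ℂ) * conj (g k) * ∫ l, g l * g (k - l)
      = ∫ z : Space × Space, (xi (z.1 + z.2) : ℂ) * Φ z := by
    have hT := measurePreserving_sub_prod (volume : Measure Space) (volume : Measure Space)
    have hint := hT.integrable_comp_of_integrable i1
    have h1 := integral_prod _ hint
    rw [← comp hT (h := fun z => (xi (z.1 + z.2) : ℂ) * Φ z) (by fun_prop),
      Measure.volume_eq_prod]
    refine Eq.trans ?_ h1.symm
    simp [Φ, ← integral_const_mul, mul_assoc]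
  rw [e0]
  linear_combination (1 / 3) * e1 + (2 / 3) * e2

/-! ### Regular functions have finite mass -/

/-- The weight of `E^4` dominates `max 1 |ξ|` times `R = 1 + ξ² + 2|η|`; the transverse growth comes
from `|η|/|ξ|`, as `(1 + ξ²)/|ξ| ≥ 2`. With `p` the root density this says `p² R ≤ W |g|`, which
leaves a dichotomy between the energy density and an integrable function of `k`. -/
theorem exists_threeHalvesMass_le : ∃ C : ENNReal, C < ⊤ ∧
    ∀ f : L2, threeHalvesMass (fun k => (𝓕 f : L2) k) ≤ energyNorm 4 f ^ 2 + C := by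
  have hint : Integrable fun k : Space => (1 + ‖k‖ ^ 2) ^ (-(6 : ℝ) / 2) :=
    integrable_rpow_neg_one_add_norm_sq (by simp; norm_num)
  refine ⟨∫⁻ k : Space, ENNReal.ofReal ((1 + ‖k‖ ^ 2) ^ (-(6 : ℝ) / 2)),
    hint.lintegral_lt_top, fun f => ?_⟩
  set g : Space → ℂ := fun k => (𝓕 f : L2) k with hgdef
  have hg : StronglyMeasurable g := Lp.stronglyMeasurable _
  let W : Space → ℝ := fun k => (1 + xi k ^ 2) ^ ((4 : ℝ) / 2) * (1 + √(etaSq k) / |xi k|)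
  have hE : energyNorm 4 f ^ 2 = ∫⁻ k, ENNReal.ofReal ((W k * ‖g k‖) ^ 2) := by
    rw [energyNorm, eLpNorm_eq_lintegral_rpow_enorm_toReal (by norm_num) (by norm_num),
      ← ENNReal.rpow_natCast, ← ENNReal.rpow_mul]
    simp only [ENNReal.toReal_ofNat, Nat.cast_ofNat, one_div, isUnit_iff_ne_zero, ne_eq,
      OfNat.ofNat_ne_zero, not_false_eq_true, IsUnit.inv_mul_cancel, ENNReal.rpow_one]
    refine lintegral_congr fun k => ?_
    rw [← ofReal_norm, ENNReal.ofReal_rpow_of_nonneg (norm_nonneg _) (by norm_num),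
      norm_mul, Complex.norm_real, Real.norm_of_nonneg (by positivity)]
    norm_cast
  have hmeas : Measurable fun k : Space => ENNReal.ofReal ((1 + ‖k‖ ^ 2) ^ (-(6 : ℝ) / 2)) := by
    fun_prop
  rw [hE, threeHalvesMass, ← lintegral_add_right _ hmeas]
  apply lintegral_mono_ae
  filter_upwards [ae_xi_ne_zero] with k hk
  rw [← ENNReal.ofReal_add (by positivity) (by positivity)]
  apply ENNReal.ofReal_le_ofReal
  set p := rootDensity g k with hp
  have hp0 : 0 ≤ p := rootDensity_nonneg _ _
  set x := |xi k| with hx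
  have hx0 : 0 < x := abs_pos.2 hk
  set e := √(etaSq k) with he
  have he0 : 0 ≤ e := Real.sqrt_nonneg _
  set R := 1 + x ^ 2 + 2 * e with hR
  have hR0 : 0 < R := by positivity
  have hRk : 1 + ‖k‖ ^ 2 ≤ R ^ 2 := by
    have h1 : ‖k‖ ^ 2 ≤ x ^ 2 + e ^ 2 := by
      rw [hx, he, sq_abs, Real.sq_sqrt (etaSq_nonneg k), EuclideanSpace.real_norm_sq_eq, xi,
        etaSq, Fin.sum_univ_three]
      have hpi : 1 ≤ (2 * Real.pi) ^ 2 := by nlinarith [Real.pi_gt_three]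
      nlinarith [sq_nonneg (k 0), sq_nonneg (k 1), sq_nonneg (k 2),
        mul_nonneg (sub_nonneg.2 hpi) (sq_nonneg (k 0)),
        mul_nonneg (sub_nonneg.2 hpi) (sq_nonneg (k 1)),
        mul_nonneg (sub_nonneg.2 hpi) (sq_nonneg (k 2))]
    rw [hR]
    nlinarith [sq_nonneg (x ^ 2), mul_nonneg (sq_nonneg x) he0, sq_nonneg e]
  have hW : max 1 x * R ≤ W k := by
    have hW' : W k = (1 + x ^ 2) ^ 2 * (1 + e / x) := by
      simp only [W, hx, sq_abs, he]
      norm_num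
    have h1 : R ≤ (1 + x ^ 2) * (1 + e / x) := by
      have : 2 * e ≤ (1 + x ^ 2) * (e / x) := by
        rw [mul_div_assoc', le_div_iff₀ hx0]
        nlinarith [mul_nonneg he0 (sq_nonneg (x - 1))]
      rw [hR]; linarith
    have h2 : max 1 x ≤ 1 + x ^ 2 := max_le (by nlinarith) (by nlinarith [sq_nonneg (x - 1)])
    calc max 1 x * R ≤ (1 + x ^ 2) * ((1 + x ^ 2) * (1 + e / x)) := by gcongr
      _ = W k := by rw [hW']; ring
  have hpF : p ^ 2 * R ≤ W k * ‖g k‖ := by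
    rw [hp, rootDensity_sq, mul_assoc, mul_comm]
    gcongr
  -- If `p ≥ R⁻²`, then `p³ ≤ p⁴ R² ≤ (W |g|)²`. Otherwise `p³ ≤ R⁻⁶ ≤ (1 + |k|²)⁻³`, which is
  -- integrable in dimension three.
  rcases le_total (1 / R ^ 2) p with h | h
  · have h1 : 1 ≤ p * R ^ 2 := by rwa [div_le_iff₀ (by positivity)] at h
    have : p ^ 3 ≤ (W k * ‖g k‖) ^ 2 := by
      calc p ^ 3 ≤ p ^ 3 * (p * R ^ 2) := le_mul_of_one_le_right (by positivity) h1
        _ = (p ^ 2 * R) ^ 2 := by ring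
        _ ≤ _ := by gcongr
    have h3 : 0 ≤ (1 + ‖k‖ ^ 2) ^ (-(6 : ℝ) / 2) := by positivity
    linarith
  · have : p ^ 3 ≤ (1 + ‖k‖ ^ 2) ^ (-(6 : ℝ) / 2) := by
      have e1 : (1 + ‖k‖ ^ 2) ^ (-(6 : ℝ) / 2) = 1 / (1 + ‖k‖ ^ 2) ^ 3 := by
        rw [show (-(6 : ℝ) / 2) = -(3 : ℕ) by norm_num, Real.rpow_neg (by positivity),
          Real.rpow_natCast, one_div]
      rw [e1]
      calc p ^ 3 ≤ (1 / R ^ 2) ^ 3 := by gcongr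
        _ = 1 / (R ^ 2) ^ 3 := by rw [div_pow, one_pow]
        _ ≤ _ := by gcongr
    have h3 : 0 ≤ (W k * ‖g k‖) ^ 2 := by positivity
    linarith


/-! ### Conservation of the `L²` norm for regular solutions -/

theorem fourier_sub (f g : L2) : 𝓕 (f - g) = (𝓕 f : L2) - 𝓕 g :=
  map_sub (Lp.fourierTransformₗᵢ Space ℂ) f g

theorem measurable_etaSq : Measurable etaSq := continuous_etaSq.measurable

theorem measurable_omega (α : ℝ) : Measurable (omega α) := by
  have := measurable_xi
  have := measurable_etaSq
  unfold omega
  fun_prop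

theorem aestronglyMeasurable_energy (σ : ℝ) (f : L2) : AEStronglyMeasurable (fun k : Space =>
    (((1 + xi k ^ 2) ^ (σ / 2) * (1 + √(etaSq k) / |xi k|) : ℝ) : ℂ) * (𝓕 f : L2) k) := by
  refine AEStronglyMeasurable.mul ?_ (Lp.aestronglyMeasurable _)
  have := measurable_xi
  have := measurable_etaSq
  exact Measurable.aestronglyMeasurable (by fun_prop)

theorem energyNorm_le_add (σ : ℝ) (f g : L2) :
    energyNorm σ f ≤ energyNorm σ (f - g) + energyNorm σ g := by
  have h := eLpNorm_add_le (aestronglyMeasurable_energy σ (f - g)) (aestronglyMeasurable_energy σ g)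
    (by norm_num : (1 : ENNReal) ≤ 2)
  refine le_trans (le_of_eq ?_) h
  apply eLpNorm_congr_ae
  filter_upwards [Lp.coeFn_sub (𝓕 f : L2) (𝓕 g)] with k hk
  rw [fourier_sub]
  simp only [Pi.add_apply, hk, Pi.sub_apply]
  ring

theorem ContinuousEnergyInfty.exists_energyNorm_le {T σ : ℝ} (hσ : 0 ≤ σ) {v : ℝ → L2}
    (h : ContinuousEnergyInfty T v) :
    ∃ M : ENNReal, M < ⊤ ∧ ∀ t ∈ Icc (-T) T, energyNorm σ (v t) ≤ M := by
  refine isCompact_Icc.induction_on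
    (p := fun s => ∃ M : ENNReal, M < ⊤ ∧ ∀ t ∈ s, energyNorm σ (v t) ≤ M)
    ⟨0, by simp, by simp⟩ ?_ ?_ ?_
  · rintro s t hst ⟨M, hM, h⟩
    exact ⟨M, hM, fun x hx => h x (hst hx)⟩
  · rintro s t ⟨M, hM, h⟩ ⟨N, hN, h'⟩
    refine ⟨max M N, max_lt hM hN, ?_⟩
    rintro x (hx | hx)
    · exact (h x hx).trans (le_max_left _ _)
    · exact (h' x hx).trans (le_max_right _ _)
  · intro t₀ ht₀
    have hev : ∀ᶠ t in 𝓝[Icc (-T) T] t₀, energyNorm σ (v t - v t₀) < 1 :=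
      (h.2 σ hσ t₀ ht₀).eventually (gt_mem_nhds one_pos)
    have hlt : 1 + energyNorm σ (v t₀) < ⊤ :=
      ENNReal.add_lt_top.2 ⟨ENNReal.one_lt_top, h.1 t₀ ht₀ σ hσ⟩
    obtain ⟨s, hs, hs'⟩ := hev.exists_mem
    refine ⟨s, hs, 1 + energyNorm σ (v t₀), hlt, fun t ht => ?_⟩
    exact (energyNorm_le_add σ (v t) (v t₀)).trans (add_le_add (hs' t ht).le le_rfl)

/-- The nonlinearity in the interaction representation. -/
def forcing (α : ℝ) (u : ℝ → L2) (s : ℝ) (k : Space) : ℂ :=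
  Complex.exp (-(Complex.I * s * omega α k)) * (Complex.I * xi k * fourierSq (u s) k)

theorem continuous_forcing (α : ℝ) {u : ℝ → L2} (hu : Continuous u) (k : Space) :
    Continuous fun s => forcing α u s k := by
  have hp : Continuous fun s => (u s, k) := hu.prodMk continuous_const
  have := continuous_fourierSq_uncurry.comp hp
  simp only [Function.comp_def] at this
  unfold forcing
  fun_prop

theorem measurable_forcing (α : ℝ) (u : ℝ → L2) (s : ℝ) : Measurable (forcing α u s) := by
  have h1 := measurable_omega α
  have h2 := measurable_xi
  have h3 := (continuous_fourierSq (u s)).measurable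
  unfold forcing
  fun_prop

theorem norm_forcing (α : ℝ) (u : ℝ → L2) (s : ℝ) (k : Space) :
    ‖forcing α u s k‖ = |xi k| * ‖fourierSq (u s) k‖ := by
  rw [forcing, norm_mul, norm_mul, norm_mul, Complex.norm_I, one_mul, Complex.norm_real,
    Real.norm_eq_abs]
  have : ‖Complex.exp (-(Complex.I * s * omega α k))‖ = 1 := by
    rw [show -(Complex.I * s * omega α k) = ((-(s * omega α k) : ℝ) : ℂ) * Complex.I by
      push_cast; ring, Complex.norm_exp_ofReal_mul_I]
  rw [this, one_mul]

theorem stronglyMeasurable_forcing_uncurry (α : ℝ) {u : ℝ → L2} (hu : Continuous u) :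
    StronglyMeasurable (Function.uncurry (forcing α u)) :=
  stronglyMeasurable_uncurry_of_continuous_of_stronglyMeasurable
    (fun k => continuous_forcing α hu k) fun s => (measurable_forcing α u s).stronglyMeasurable

/-- The solution in the interaction representation. -/
def interaction (α : ℝ) (u : ℝ → L2) (t : ℝ) (k : Space) : ℂ :=
  (𝓕 (u 0) : L2) k + ∫ s in (0 : ℝ)..t, forcing α u s k

theorem hasDerivAt_interaction (α : ℝ) {u : ℝ → L2} (hu : Continuous u) (t : ℝ) (k : Space) :
    HasDerivAt (fun t => interaction α u t k) (forcing α u t k) t :=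
  ((continuous_forcing α hu k).integral_hasStrictDerivAt 0 t).hasDerivAt.const_add _

theorem continuous_interaction (α : ℝ) {u : ℝ → L2} (hu : Continuous u) (k : Space) :
    Continuous fun t => interaction α u t k :=
  continuous_iff_continuousAt.2 fun t => (hasDerivAt_interaction α hu t k).continuousAt

theorem stronglyMeasurable_interaction (α : ℝ) {u : ℝ → L2} (hu : Continuous u) (t : ℝ) :
    StronglyMeasurable (interaction α u t) := by
  refine (Lp.stronglyMeasurable _).add ?_
  have h := (stronglyMeasurable_forcing_uncurry α hu).comp_measurable measurable_swap
  have h1 (s : Set ℝ) : StronglyMeasurable fun k => ∫ t in s, forcing α u t k :=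
    StronglyMeasurable.integral_prod_right (ν := volume.restrict s) h
  exact (h1 _).sub (h1 _)

theorem IsMildSolution.ae_fourier_eq {α T : ℝ} {v : ℝ → L2} (h : IsMildSolution α T v) {t : ℝ}
    (ht : t ∈ Icc (-T) T) : ∀ᵐ k : Space, (𝓕 (v t) : L2) k =
      Complex.exp (Complex.I * t * omega α k) * interaction α v t k := by
  filter_upwards [h.duhamel t ht] with k hk
  rw [hk, interaction, mul_add, ← intervalIntegral.integral_const_mul]
  congr 1
  apply intervalIntegral.integral_congr
  intro s _
  simp only [forcing, fourierSq]
  rw [← mul_assoc (Complex.exp _) (Complex.exp _), ← Complex.exp_add]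
  congr 2
  ring

theorem norm_exp_I_mul (t : ℝ) (x : ℝ) : ‖Complex.exp (Complex.I * t * x)‖ = 1 := by
  rw [show Complex.I * t * x = ((t * x : ℝ) : ℂ) * Complex.I by push_cast; ring,
    Complex.norm_exp_ofReal_mul_I]

theorem integrable_norm_sq_coe (f : L2) : Integrable fun k => ‖f k‖ ^ 2 :=
  (memLp_coe f).integrable_norm_pow (by norm_num)

/-- Regular real-valued solutions conserve the `L²` norm. -/
theorem norm_eq_of_regular {α T : ℝ} {v : ℝ → L2} (hv : IsMildSolution α T v)
    (hE : ContinuousEnergyInfty T v) (hr : ∀ t ∈ Icc (-T) T, IsRealValued (v t : Tempered))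
    {t : ℝ} (ht : t ∈ Icc 0 T) : ‖v t‖ = ‖v 0‖ := by
  have hT : -T ≤ T := by linarith [ht.1, ht.2]
  have hsub : Icc 0 t ⊆ Icc (-T) T := Icc_subset_Icc (by linarith [ht.1, ht.2]) ht.2
  -- Freezing `v` beyond the endpoints gives a globally continuous curve, so that the interaction
  -- representation is differentiable at every time, the endpoints included.
  let u : ℝ → L2 := fun s => v (projIcc (-T) T hT s)
  have huv {s : ℝ} (hs : s ∈ Icc (-T) T) : u s = v s := by
    simp only [u, projIcc_of_mem hT hs]
  have hu : Continuous u := by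
    have := continuousOn_iff_continuous_domRestrict.1 hv.continuousOn
    exact this.comp continuous_projIcc
  have h0 : (0 : ℝ) ∈ Icc (-T) T := hsub ⟨le_rfl, ht.1⟩
  have hint {s : ℝ} (hs : s ∈ Icc 0 t) : ∀ᵐ k : Space, (𝓕 (v s) : L2) k =
      Complex.exp (Complex.I * s * omega α k) * interaction α u s k := by
    filter_upwards [hv.ae_fourier_eq (hsub hs)] with k hk
    rw [hk, interaction, interaction, huv h0]
    congr 2
    apply intervalIntegral.integral_congr
    intro r hr'
    rw [uIcc_of_le hs.1] at hr'
    simp only [forcing, huv (hsub ⟨hr'.1, hr'.2.trans hs.2⟩)]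
  obtain ⟨M, hM, hME⟩ := hE.exists_energyNorm_le (σ := 4) (by norm_num)
  obtain ⟨C, hC, hCE⟩ := exists_threeHalvesMass_le
  set B : ENNReal := 3 * (M ^ 2 + C) ^ 2 with hB
  have hBtop : B < ⊤ := ENNReal.mul_lt_top (by norm_num)
    (ENNReal.pow_lt_top (ENNReal.add_lt_top.2 ⟨ENNReal.pow_lt_top hM, hC⟩))
  have hmass {s : ℝ} (hs : s ∈ Icc 0 t) :
      threeHalvesMass (fun k => (𝓕 (v s) : L2) k) ≤ M ^ 2 + C :=
    (hCE _).trans (by gcongr; exact hME s (hsub hs))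
  -- the power is the real part of a trilinear form
  let P : ℝ → Space → ℝ := fun s k => 2 * inner ℝ (interaction α u s k) (forcing α u s k)
  let Z : ℝ → Space → ℂ := fun s k =>
    (xi k : ℂ) * conj ((𝓕 (v s) : L2) k) * ∫ l, (𝓕 (v s) : L2) l * (𝓕 (v s) : L2) (k - l)
  -- The unimodular phases of the interaction representation combine to the conjugate of the
  -- solution's own transform, leaving `Re(i Z) = -Im Z`.
  have hPZ {s : ℝ} (hs : s ∈ Icc 0 t) : ∀ᵐ k, P s k = -2 * (Z s k).im := by
    filter_upwards [hint hs] with k hk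
    simp only [P, Z, ← fourierSq_eq_convolution, forcing, huv (hsub hs)]
    rw [hk, map_mul]
    have hexp : conj (Complex.exp (Complex.I * s * omega α k))
        = Complex.exp (-(Complex.I * s * omega α k)) := by
      rw [← Complex.exp_conj]
      simp
    rw [hexp, real_inner_eq_re_inner ℂ, RCLike.inner_apply]
    set E := Complex.exp (-(Complex.I * s * omega α k))
    set A := conj (interaction α u s k)
    set F := fourierSq (v s) k
    have e1 : E * (Complex.I * xi k * F) * A = Complex.I * (xi k * (E * A) * F) := by ring
    rw [e1]
    simp
    ring
  have hZint {s : ℝ} (hs : s ∈ Icc 0 t) : ∫⁻ k, ‖Z s k‖ₑ ≤ B :=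
    (lintegral_trilinear_convolution_le (Lp.stronglyMeasurable (𝓕 (v s) : L2))).trans (by
      rw [hB]; gcongr; exact hmass hs)
  have hZmeas (s : ℝ) : AEStronglyMeasurable (Z s) := by
    have h1 := measurable_xi
    have h2 := (Lp.stronglyMeasurable (𝓕 (v s) : L2)).measurable
    have h3 := (continuous_fourierSq (v s)).measurable
    simp only [Z, ← fourierSq_eq_convolution]
    refine Measurable.aestronglyMeasurable (Measurable.mul (Measurable.mul ?_ ?_) h3)
    · fun_prop
    · exact Complex.continuous_conj.measurable.comp h2
  have hZi {s : ℝ} (hs : s ∈ Icc 0 t) : Integrable (Z s) :=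
    ⟨hZmeas s, (hZint hs).trans_lt hBtop⟩
  have hZ0 {s : ℝ} (hs : s ∈ Icc 0 t) : ∫ k, Z s k = 0 :=
    integral_trilinear_convolution_eq_zero (Lp.stronglyMeasurable (𝓕 (v s) : L2))
      ((hmass hs).trans_lt (ENNReal.add_lt_top.2 ⟨ENNReal.pow_lt_top hM, hC⟩))
      (fourier_neg_of_isRealValued (hr s (hsub hs)))
  have hPi {s : ℝ} (hs : s ∈ Icc 0 t) : Integrable (P s) :=
    ((hZi hs).im.const_mul (-2)).congr ((hPZ hs).mono fun k hk => by rw [hk]; rfl)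
  have hP0 {s : ℝ} (hs : s ∈ Icc 0 t) : ∫ k, P s k = 0 := by
    rw [integral_congr_ae (hPZ hs), integral_const_mul]
    have := integral_im (𝕜 := ℂ) (hZi hs)
    simp only [RCLike.im_to_complex] at this
    rw [this, hZ0 hs]
    simp
  have hPnorm {s : ℝ} (hs : s ∈ Icc 0 t) : ∫ k, ‖P s k‖ ≤ 2 * B.toReal := by
    calc ∫ k, ‖P s k‖ ≤ ∫ k, 2 * ‖Z s k‖ := by
          apply integral_mono_ae (hPi hs).norm ((hZi hs).norm.const_mul 2)
          filter_upwards [hPZ hs] with k hk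
          rw [hk, norm_mul]
          norm_num
          exact Complex.abs_im_le_norm _
      _ = 2 * (∫⁻ k, ‖Z s k‖ₑ).toReal := by
          rw [integral_const_mul, integral_norm_eq_lintegral_enorm (hZmeas s)]
      _ ≤ _ := by gcongr; exacts [hBtop.ne, hZint hs]
  have hPcont (k : Space) : Continuous fun s => P s k := by
    have h1 := continuous_interaction α hu k
    have h2 := continuous_forcing α hu k
    simp only [P]
    fun_prop
  have hPm : StronglyMeasurable (Function.uncurry P) :=
    stronglyMeasurable_uncurry_of_continuous_of_stronglyMeasurable hPcont fun s =>
      (((stronglyMeasurable_interaction α hu s).inner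
        (measurable_forcing α u s).stronglyMeasurable).const_mul 2)
  have hPprod : Integrable (Function.uncurry P)
      ((volume.restrict (uIoc 0 t)).prod (volume : Measure Space)) := by
    rw [integrable_prod_iff hPm.aestronglyMeasurable]
    have hmem : ∀ᵐ s ∂volume.restrict (uIoc 0 t), s ∈ Icc 0 t := by
      filter_upwards [ae_restrict_mem measurableSet_uIoc] with s hs
      rw [uIoc_of_le ht.1] at hs
      exact Ioc_subset_Icc_self hs
    refine ⟨hmem.mono fun s hs => hPi hs, ?_⟩
    refine Integrable.mono' (g := fun _ => 2 * B.toReal) ?_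
      (hPm.norm.integral_prod_right.aestronglyMeasurable) ?_
    · rw [uIoc_of_le ht.1]
      exact integrable_const _
    · filter_upwards [hmem] with s hs
      rw [Real.norm_of_nonneg (integral_nonneg fun _ => norm_nonneg _)]
      exact hPnorm hs
  have hFTC (k : Space) : ∫ s in (0 : ℝ)..t, P s k
      = ‖interaction α u t k‖ ^ 2 - ‖interaction α u 0 k‖ ^ 2 := by
    apply intervalIntegral.integral_eq_sub_of_hasDerivAt
    · intro s _
      exact (hasDerivAt_interaction α hu s k).norm_sq
    · exact (hPcont k).intervalIntegrable _ _
  -- The norm is never differentiated directly: the fundamental theorem of calculus is applied at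
  -- each fixed frequency, and Fubini exchanges time and frequency.
  have hfub := intervalIntegral_integral_swap (f := P) (a := 0) (b := t) hPprod
  have hzero : ∫ s in (0 : ℝ)..t, ∫ k, P s k = 0 := by
    rw [intervalIntegral.integral_congr (g := fun _ => (0 : ℝ))]
    · simp
    · intro s hs
      rw [uIcc_of_le ht.1] at hs
      exact hP0 hs
  have hnorm {s : ℝ} (hs : s ∈ Icc 0 t) :
      (fun k => ‖interaction α u s k‖ ^ 2) =ᵐ[volume] fun k => ‖(𝓕 (v s) : L2) k‖ ^ 2 := by
    filter_upwards [hint hs] with k hk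
    rw [hk, norm_mul, norm_exp_I_mul, one_mul]
  have ht' : t ∈ Icc 0 t := ⟨ht.1, le_rfl⟩
  have h0' : (0 : ℝ) ∈ Icc 0 t := ⟨le_rfl, ht.1⟩
  have hfinal : ∫ k, (∫ s in (0 : ℝ)..t, P s k) = ‖v t‖ ^ 2 - ‖v 0‖ ^ 2 := by
    simp_rw [hFTC]
    rw [integral_sub ((integrable_norm_sq_coe _).congr (hnorm ht').symm)
      ((integrable_norm_sq_coe _).congr (hnorm h0').symm), integral_congr_ae (hnorm ht'),
      integral_congr_ae (hnorm h0'), ← norm_sq_eq_integral, ← norm_sq_eq_integral,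
      Lp.norm_fourier_eq, Lp.norm_fourier_eq]
  rw [← hfub, hzero] at hfinal
  have : ‖v t‖ ^ 2 = ‖v 0‖ ^ 2 := by linarith
  exact (pow_left_inj₀ (norm_nonneg _) (norm_nonneg _) two_ne_zero).1 this



/-! ### The free evolution -/

theorem memLp_exp_mul (α t : ℝ) (f : L2) :
    MemLp (fun k => Complex.exp (Complex.I * t * omega α k) * f k) 2 (volume : Measure Space) := by
  refine (memLp_coe f).of_le ?_ (ae_of_all _ fun k => ?_)
  · have := measurable_omega α
    exact AEStronglyMeasurable.mul (Measurable.aestronglyMeasurable (by fun_prop)) (memLp_coe f).1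
  · rw [norm_mul, norm_exp_I_mul, one_mul]

/-- The unitary group `S_α(t)`. -/
def freeEvolution (α : ℝ) (f : L2) (t : ℝ) : L2 := 𝓕⁻ ((memLp_exp_mul α t (𝓕 f)).toLp)

theorem fourier_freeEvolution (α : ℝ) (f : L2) (t : ℝ) :
    ∀ᵐ k, (𝓕 (freeEvolution α f t) : L2) k =
      Complex.exp (Complex.I * t * omega α k) * (𝓕 f : L2) k := by
  rw [freeEvolution, fourier_fourierInv_eq]
  exact MemLp.coeFn_toLp _

theorem norm_freeEvolution (α : ℝ) (f : L2) (t : ℝ) : ‖freeEvolution α f t‖ = ‖f‖ := by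
  have : ‖freeEvolution α f t‖ ^ 2 = ‖f‖ ^ 2 := by
    rw [← Lp.norm_fourier_eq, ← Lp.norm_fourier_eq f, norm_sq_eq_integral, norm_sq_eq_integral]
    apply integral_congr_ae
    filter_upwards [fourier_freeEvolution α f t] with k hk
    rw [hk, norm_mul, norm_exp_I_mul, one_mul]
  exact (pow_left_inj₀ (norm_nonneg _) (norm_nonneg _) two_ne_zero).1 this

/-- The transform of the integrable function `v²` is bounded pointwise, so at a fixed frequency the
derivative costs only the harmless factor `|ξ|`. The nonlinear correction is thus quadratic in the
size of the solution. -/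
theorem IsMildSolution.ae_norm_fourier_sub_le {α T c : ℝ} {v : ℝ → L2}
    (h : IsMildSolution α T v) (hc : ∀ s ∈ Icc 0 T, ‖v s‖ ≤ c) {t : ℝ} (ht : t ∈ Icc 0 T) :
    ∀ᵐ k : Space, ‖(𝓕 (v t) : L2) k - Complex.exp (Complex.I * t * omega α k) * (𝓕 (v 0) : L2) k‖
      ≤ |xi k| * T * c ^ 2 := by
  filter_upwards [h.ae_fourier_eq (⟨by linarith [ht.1, ht.2], ht.2⟩ : t ∈ Icc (-T) T)] with k hk
  rw [hk, interaction, mul_add, add_sub_cancel_left, norm_mul, norm_exp_I_mul, one_mul]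
  have hc0 : 0 ≤ c := (norm_nonneg _).trans (hc t ht)
  calc ‖∫ s in (0 : ℝ)..t, forcing α v s k‖ ≤ |xi k| * c ^ 2 * |t - 0| := by
        apply intervalIntegral.norm_integral_le_of_norm_le_const
        intro s hs
        rw [uIoc_of_le ht.1] at hs
        rw [norm_forcing]
        gcongr
        refine (norm_fourierSq_le _ _).trans ?_
        gcongr
        exact hc s ⟨hs.1.le, hs.2.trans ht.2⟩
    _ ≤ |xi k| * c ^ 2 * T := by
        rw [sub_zero, abs_of_nonneg ht.1]
        gcongr
        exact ht.2
    _ = _ := by ring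

theorem fourier_smul (c : ℂ) (f : L2) : 𝓕 (c • f) = c • (𝓕 f : L2) :=
  map_smul (Lp.fourierTransformₗᵢ Space ℂ) c f

theorem ae_fourier_smul (c : ℂ) (f : L2) : ∀ᵐ k, (𝓕 (c • f) : L2) k = c * (𝓕 f : L2) k := by
  rw [fourier_smul]
  exact Lp.coeFn_smul c _

theorem forcing_smul (α : ℝ) (u : ℝ → L2) (c : ℂ) (s : ℝ) (k : Space) :
    forcing α (fun s => c • u s) s k = c ^ 2 * forcing α u s k := by
  simp only [forcing, fourierSq_smul]
  ring

theorem continuousOn_forcing (α : ℝ) {u : ℝ → L2} {A : Set ℝ} (hu : ContinuousOn u A) (k : Space) :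
    ContinuousOn (fun s => forcing α u s k) A := by
  have hp : ContinuousOn (fun s => (u s, k)) A := hu.prodMk continuousOn_const
  have := continuous_fourierSq_uncurry.comp_continuousOn hp
  simp only [Function.comp_def] at this
  unfold forcing
  fun_prop

/-- The second Picard iterate. -/
def secondIterate (α : ℝ) (f : L2) (t : ℝ) (k : Space) : ℂ :=
  ∫ s in (0 : ℝ)..t, forcing α (freeEvolution α f) s k

/-- The nonlinearity is homogeneous of degree two, so the rescaled remainder is exactly the Duhamel
integral of `v_n / h_n`. Its integrand converges by joint continuity of `fourierSq` and is dominated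
by `|ξ| c²`. -/
theorem tendsto_second_order {α T c : ℝ} {f : L2} {h : ℕ → ℝ} {v : ℕ → ℝ → L2}
    (hh : ∀ n, h n ≠ 0) (hv : ∀ n, IsMildSolution α T (v n))
    (hv0 : ∀ n, v n 0 = (h n : ℂ) • f)
    (hc : ∀ n, ∀ s ∈ Icc 0 T, ‖v n s‖ ≤ c * |h n|)
    (hlim : ∀ s ∈ Icc 0 T, Tendsto (fun n => ((h n)⁻¹ : ℂ) • v n s) atTop
      (𝓝 (freeEvolution α f s))) {t : ℝ} (ht : t ∈ Icc 0 T) :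
    ∀ᵐ k, Tendsto (fun n => ((h n)⁻¹ : ℂ) ^ 2 * ((𝓕 (v n t) : L2) k
        - Complex.exp (Complex.I * t * omega α k) * (h n * (𝓕 f : L2) k))) atTop
      (𝓝 (Complex.exp (Complex.I * t * omega α k) * secondIterate α f t k)) := by
  have htT : t ∈ Icc (-T) T := ⟨by linarith [ht.1, ht.2], ht.2⟩
  have h1 : ∀ᵐ k, ∀ n, (𝓕 (v n t) : L2) k =
      Complex.exp (Complex.I * t * omega α k) * interaction α (v n) t k :=
    ae_all_iff.2 fun n => (hv n).ae_fourier_eq htT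
  have h2 : ∀ᵐ k, ∀ n, (𝓕 (v n 0) : L2) k = h n * (𝓕 f : L2) k := by
    refine ae_all_iff.2 fun n => ?_
    rw [hv0]
    exact ae_fourier_smul _ _
  filter_upwards [h1, h2] with k hk1 hk2
  have e (n : ℕ) : ((h n)⁻¹ : ℂ) ^ 2 * ((𝓕 (v n t) : L2) k
        - Complex.exp (Complex.I * t * omega α k) * (h n * (𝓕 f : L2) k))
      = Complex.exp (Complex.I * t * omega α k) *
        ∫ s in (0 : ℝ)..t, forcing α (fun s => ((h n)⁻¹ : ℂ) • v n s) s k := by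
    simp_rw [forcing_smul, intervalIntegral.integral_const_mul]
    rw [hk1, interaction, hk2]
    ring
  simp_rw [e]
  refine Tendsto.const_mul _ ?_
  have hsub : uIoc 0 t ⊆ Icc 0 T := by
    rw [uIoc_of_le ht.1]
    exact fun s hs => ⟨hs.1.le, hs.2.trans ht.2⟩
  have hb (n : ℕ) {s : ℝ} (hs : s ∈ Icc 0 T) : ‖((h n)⁻¹ : ℂ) • v n s‖ ≤ c := by
    rw [norm_smul, norm_inv, Complex.norm_real, Real.norm_eq_abs, inv_mul_le_iff₀
      (abs_pos.2 (hh n)), mul_comm]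
    exact hc n s hs
  apply intervalIntegral.tendsto_integral_filter_of_dominated_convergence
    (fun _ => |xi k| * c ^ 2)
  · refine Eventually.of_forall fun n => ContinuousOn.aestronglyMeasurable ?_ measurableSet_uIoc
    apply continuousOn_forcing
    have := (hv n).continuousOn.mono
      (hsub.trans (Icc_subset_Icc (by linarith [ht.1, ht.2]) le_rfl))
    exact this.const_smul ((h n)⁻¹ : ℂ)
  · refine Eventually.of_forall fun n => ae_of_all _ fun s hs => ?_
    rw [norm_forcing]
    gcongr
    refine (norm_fourierSq_le _ _).trans ?_
    gcongr
    exact hb n (hsub hs)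
  · simp
  · refine ae_of_all _ fun s hs => ?_
    have hp : Tendsto (fun n => (((h n)⁻¹ : ℂ) • v n s, k)) atTop (𝓝 (freeEvolution α f s, k)) :=
      (hlim s (hsub hs)).prodMk_nhds tendsto_const_nhds
    have := (continuous_fourierSq_uncurry.tendsto (freeEvolution α f s, k)).comp hp
    simp only [Function.comp_def] at this
    unfold forcing
    exact (this.const_mul _).const_mul _

/-- Convergence to the free evolution under conservation of the norm. -/
theorem tendsto_freeEvolution_of_norm_eq {α T : ℝ} {f : L2} {h : ℕ → ℝ} {v : ℕ → ℝ → L2}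
    (hf : Integrable fun k => |xi k| * ‖(𝓕 f : L2) k‖)
    (hh : ∀ n, h n ≠ 0) (hh0 : Tendsto h atTop (𝓝 0)) (hv : ∀ n, IsMildSolution α T (v n))
    (hv0 : ∀ n, v n 0 = (h n : ℂ) • f) (hn : ∀ n, ∀ s ∈ Icc 0 T, ‖v n s‖ = ‖v n 0‖)
    {t : ℝ} (ht : t ∈ Icc 0 T) :
    Tendsto (fun n => ((h n)⁻¹ : ℂ) • v n t) atTop (𝓝 (freeEvolution α f t)) := by
  have hT : 0 ≤ T := ht.1.trans ht.2
  set S := freeEvolution α f t with hS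
  have hnorm (n : ℕ) : ‖((h n)⁻¹ : ℂ) • v n t‖ = ‖f‖ := by
    rw [norm_smul, hn n t ht, hv0, norm_smul, ← mul_assoc, norm_inv, inv_mul_cancel₀, one_mul]
    simpa using hh n
  have hpt (n : ℕ) : ∀ᵐ k, ‖(𝓕 (S - ((h n)⁻¹ : ℂ) • v n t) : L2) k‖
      ≤ |h n| * (|xi k| * T * ‖f‖ ^ 2) := by
    have hc : ∀ s ∈ Icc 0 T, ‖v n s‖ ≤ |h n| * ‖f‖ := fun s hs => by
      rw [hn n s hs, hv0, norm_smul, Complex.norm_real, Real.norm_eq_abs]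
    have a1 := (hv n).ae_norm_fourier_sub_le hc ht
    have a2 := ae_fourier_smul (h n) f
    rw [← hv0] at a2
    rw [fourier_sub]
    filter_upwards [a1, a2, Lp.coeFn_sub (𝓕 S : L2) (𝓕 (((h n)⁻¹ : ℂ) • v n t)),
      ae_fourier_smul ((h n)⁻¹ : ℂ) (v n t), fourier_freeEvolution α f t] with k k1 k2 k3 k4 k5
    rw [k3, Pi.sub_apply, k4, hS, k5]
    rw [k2] at k1
    have hne : (h n : ℂ) ≠ 0 := by exact_mod_cast hh n
    have e : Complex.exp (Complex.I * t * omega α k) * (𝓕 f : L2) k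
        - ((h n)⁻¹ : ℂ) * (𝓕 (v n t) : L2) k
        = -((h n)⁻¹ : ℂ) * ((𝓕 (v n t) : L2) k
          - Complex.exp (Complex.I * t * omega α k) * (h n * (𝓕 f : L2) k)) := by
      field_simp
      ring
    rw [e, norm_mul, norm_neg, norm_inv, Complex.norm_real, Real.norm_eq_abs,
      inv_mul_le_iff₀ (abs_pos.2 (hh n))]
    refine k1.trans (le_of_eq ?_)
    ring
  set J := ∫ k, |xi k| * ‖(𝓕 f : L2) k‖ with hJ
  -- The pointwise error carries a factor `|ξ|`; pairing it with the free evolution absorbs that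
  -- factor into the integrability of `|ξ| |f̂|`.
  have hinner (n : ℕ) : ‖inner ℂ S (S - ((h n)⁻¹ : ℂ) • v n t)‖
      ≤ |h n| * (T * ‖f‖ ^ 2 * J) := by
    rw [← Lp.inner_fourier_eq, L2.inner_def]
    calc _ ≤ ∫ k, |h n| * (T * ‖f‖ ^ 2) * (|xi k| * ‖(𝓕 f : L2) k‖) := by
          refine norm_integral_le_of_norm_le (hf.const_mul _) ?_
          filter_upwards [hpt n, fourier_freeEvolution α f t] with k k1 k2
          refine (norm_inner_le_norm _ _).trans ?_
          rw [hS, k2, norm_mul, norm_exp_I_mul, one_mul]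
          calc _ ≤ ‖(𝓕 f : L2) k‖ * (|h n| * (|xi k| * T * ‖f‖ ^ 2)) := by gcongr
            _ = _ := by ring
      _ = _ := by rw [integral_const_mul, hJ]; ring
  -- For vectors `a`, `S` of equal norm, `‖a - S‖² = 2 Re ⟨S, S - a⟩`.
  have hsq (n : ℕ) : ‖((h n)⁻¹ : ℂ) • v n t - S‖ ^ 2 ≤ 2 * (|h n| * (T * ‖f‖ ^ 2 * J)) := by
    have e1 := norm_sub_sq (𝕜 := ℂ) S (((h n)⁻¹ : ℂ) • v n t)
    have e2 := inner_sub_right (𝕜 := ℂ) S S (((h n)⁻¹ : ℂ) • v n t)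
    have e3 := (Complex.abs_re_le_norm (inner ℂ S (S - ((h n)⁻¹ : ℂ) • v n t))).trans (hinner n)
    have e4 := inner_self_eq_norm_sq (𝕜 := ℂ) S
    rw [e2, Complex.sub_re] at e3
    simp only [RCLike.re_to_complex] at e1 e4
    rw [norm_sub_rev, e1, hnorm, hS, norm_freeEvolution, ← hS]
    have e5 := (le_abs_self _).trans e3
    rw [e4, hS, norm_freeEvolution, ← hS] at e5
    linarith
  rw [tendsto_iff_norm_sub_tendsto_zero]
  have hlim : Tendsto (fun n => √(2 * (|h n| * (T * ‖f‖ ^ 2 * J)))) atTop (𝓝 0) := by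
    have : Tendsto (fun n => 2 * (|h n| * (T * ‖f‖ ^ 2 * J))) atTop (𝓝 0) := by
      simpa using ((hh0.abs.mul_const (T * ‖f‖ ^ 2 * J)).const_mul 2)
    simpa using this.sqrt
  exact squeeze_zero (fun _ => norm_nonneg _) (fun n => Real.le_sqrt_of_sq_le (hsq n)) hlim


/-! ### Second-order expansion of the flow map -/

/-- The derivative is C¹ at the origin, hence Lipschitz nearby; the mean value inequality for `Γ -
Γ'(0)` on the ball of radius `‖x‖` gains the second power. -/
theorem ContDiffAt.exists_sub_le_sq {E F : Type*} [NormedAddCommGroup E] [NormedSpace ℝ E]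
    [NormedAddCommGroup F] [NormedSpace ℝ F] {Γ : E → F} (h : ContDiffAt ℝ 2 Γ 0)
    (h0 : Γ 0 = 0) : ∃ (L : E →L[ℝ] F) (K : ℝ), 0 ≤ K ∧ ∀ᶠ x in 𝓝 0, ‖Γ x - L x‖ ≤ K * ‖x‖ ^ 2 := by
  have h1 : ContDiffAt ℝ 1 (fderiv ℝ Γ) 0 := h.fderiv_right (by norm_num)
  obtain ⟨K, s, hs, hK⟩ := h1.exists_lipschitzOnWith
  have hd : ∀ᶠ x in 𝓝 (0 : E), DifferentiableAt ℝ Γ x :=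
    (h.eventually (by simp)).mono fun x hx => hx.differentiableAt (by norm_num)
  obtain ⟨r, hr, hball⟩ := Metric.eventually_nhds_iff_ball.1 (hd.and (show ∀ᶠ x in 𝓝 0, x ∈ s from hs))
  refine ⟨fderiv ℝ Γ 0, K, K.2, ?_⟩
  filter_upwards [Metric.ball_mem_nhds (0 : E) hr] with x hx
  rw [mem_ball_zero_iff] at hx
  have hsub {y : E} (hy : y ∈ Metric.closedBall (0 : E) ‖x‖) : y ∈ Metric.ball (0 : E) r := by
    rw [mem_ball_zero_iff]
    rw [mem_closedBall_zero_iff] at hy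
    exact hy.trans_lt hx
  have := (convex_closedBall (0 : E) ‖x‖).norm_image_sub_le_of_norm_hasFDerivWithin_le
    (f := fun y => Γ y - fderiv ℝ Γ 0 y) (f' := fun y => fderiv ℝ Γ y - fderiv ℝ Γ 0)
    (C := K * ‖x‖) (x := 0) (y := x)
    (fun y hy => ((hball y (hsub hy)).1.hasFDerivAt.sub
      (fderiv ℝ Γ 0).hasFDerivAt).hasFDerivWithinAt)
    (fun y hy => by
      have := hK.norm_sub_le (hball y (hsub hy)).2 (hball 0 (by simpa using hr)).2
      refine this.trans ?_
      rw [sub_zero]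
      gcongr
      simpa using hy)
    (by simp) (by simp)
  simp only [h0, map_zero, sub_zero] at this
  linarith [this, show (K : ℝ) * ‖x‖ * ‖x‖ = K * ‖x‖ ^ 2 by ring]

theorem energyNorm_smul (σ : ℝ) (c : ℂ) (f : L2) :
    energyNorm σ (c • f) = ‖c‖ₑ * energyNorm σ f := by
  rw [energyNorm, energyNorm, ← eLpNorm_const_smul]
  apply eLpNorm_congr_ae
  filter_upwards [ae_fourier_smul c f] with k hk
  simp only [hk, Pi.smul_apply, smul_eq_mul]
  ring

theorem MemEnergyInfty.smul {f : L2} (h : MemEnergyInfty f) (c : ℂ) : MemEnergyInfty (c • f) :=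
  fun σ hσ => by
    rw [energyNorm_smul]
    exact ENNReal.mul_lt_top enorm_lt_top (h σ hσ)

theorem one_le_weight {s₁ s₂ : ℝ} (h₁ : 0 ≤ s₁) (h₂ : 0 ≤ s₂) (k : Space) :
    1 ≤ weight s₁ s₂ k := by
  have := etaSq_nonneg k
  exact one_le_mul_of_one_le_of_one_le (Real.one_le_rpow (by nlinarith [sq_nonneg (xi k)])
    (by positivity)) (Real.one_le_rpow (by linarith) (by positivity))

theorem eLpNorm_fourier_eq (f : L2) : eLpNorm (fun k => (𝓕 f : L2) k) 2 volume = ‖f‖ₑ := by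
  rw [← ofReal_norm, ← Lp.norm_fourier_eq, Lp.norm_def, ENNReal.ofReal_toReal]
  exact (memLp_coe (𝓕 f)).2.ne

namespace Sobolev

variable {s₁ s₂ : ℝ}

/-- The element of the Sobolev space given by a square integrable function. -/
def ofL2 (f : L2) (hr : IsRealValued (f : Tempered))
    (hm : MemLp (fun k => (weight s₁ s₂ k : ℂ) * (𝓕 f : L2) k) 2 volume) : Sobolev s₁ s₂ :=
  ⟨(f : Tempered), hr, 𝓕⁻ hm.toLp, (bessel_coe_eq_coe_iff _ _ _ _).2 (by
    rw [fourier_fourierInv_eq]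
    exact hm.coeFn_toLp)⟩

theorem isRealValued_toTempered (φ : Sobolev s₁ s₂) : IsRealValued φ.toTempered := φ.2.1

theorem toTempered_smul (c : ℝ) {φ : Sobolev s₁ s₂} {f : L2} (h : φ.toTempered = (f : Tempered)) :
    (c • φ).toTempered = (((c : ℂ) • f : L2) : Tempered) := by
  have e1 : (c • φ).toTempered = c • φ.toTempered := rfl
  have e2 : c • (f : Tempered) = (c : ℂ) • (f : Tempered) := by ext ψ; simp
  rw [e1, h, e2, ← Lp.toTemperedDistributionCLM_apply, ← Lp.toTemperedDistributionCLM_apply,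
    map_smul]

theorem enorm_eq (φ : Sobolev s₁ s₂) {f : L2} (h : φ.toTempered = (f : Tempered)) :
    ‖φ‖ₑ = eLpNorm (fun k => (weight s₁ s₂ k : ℂ) * (𝓕 f : L2) k) 2 volume := by
  rw [← eLpNorm_congr_ae (fourier_toL2 φ h), eLpNorm_fourier_eq, ← ofReal_norm, ← ofReal_norm,
    norm_def]

end Sobolev

theorem coe_injective {f g : L2} (h : (f : Tempered) = (g : Tempered)) : f = g :=
  coe_L2_injective h

/-- Convergence to the free evolution under differentiability in the Sobolev space. -/
theorem tendsto_freeEvolution_of_differentiable {α T c s₁ s₂ : ℝ} (h₁ : 0 ≤ s₁) (h₂ : 0 ≤ s₂)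
    {f : L2} {h : ℕ → ℝ} {v : ℕ → ℝ → L2}
    (hh : ∀ n, h n ≠ 0) (hh0 : Tendsto h atTop (𝓝 0)) (hv : ∀ n, IsMildSolution α T (v n))
    (hv0 : ∀ n, v n 0 = (h n : ℂ) • f) (hc : ∀ n, ∀ s ∈ Icc 0 T, ‖v n s‖ ≤ c * |h n|)
    {t : ℝ} (ht : t ∈ Icc 0 T) {ψ : ℕ → Sobolev s₁ s₂} (hψ : ∀ n, (ψ n).toTempered = (v n t : L2))
    {χ : Sobolev s₁ s₂} (hχ : Tendsto (fun n => (h n)⁻¹ • ψ n) atTop (𝓝 χ)) :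
    Tendsto (fun n => ((h n)⁻¹ : ℂ) • v n t) atTop (𝓝 (freeEvolution α f t)) := by
  have hD0 : Tendsto (fun n => ‖(h n)⁻¹ • ψ n - χ‖) atTop (𝓝 0) :=
    tendsto_iff_norm_sub_tendsto_zero.1 hχ
  set G : L2 := 𝓕 (Sobolev.toL2 s₁ s₂ χ) with hG
  have hD : ∀ᵐ k, ∀ n, (𝓕 (Sobolev.toL2 s₁ s₂ ((h n)⁻¹ • ψ n - χ)) : L2) k
      = weight s₁ s₂ k * (((h n)⁻¹ : ℂ) * (𝓕 (v n t) : L2) k) - G k := by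
    refine ae_all_iff.2 fun n => ?_
    have e1 := Sobolev.fourier_toL2 ((h n)⁻¹ • ψ n) (Sobolev.toTempered_smul _ (hψ n))
    rw [map_sub, fourier_sub]
    filter_upwards [e1, Lp.coeFn_sub (𝓕 (Sobolev.toL2 s₁ s₂ ((h n)⁻¹ • ψ n)) : L2) G,
      ae_fourier_smul (((h n)⁻¹ : ℝ) : ℂ) (v n t)] with k k1 k2 k3
    rw [k2, Pi.sub_apply, k1, k3, Complex.ofReal_inv]
  have hpt : ∀ᵐ k, Tendsto (fun n => ((h n)⁻¹ : ℂ) * (𝓕 (v n t) : L2) k) atTop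
      (𝓝 (Complex.exp (Complex.I * t * omega α k) * (𝓕 f : L2) k)) := by
    have a1 : ∀ᵐ k, ∀ n, ‖(𝓕 (v n t) : L2) k
        - Complex.exp (Complex.I * t * omega α k) * (𝓕 (v n 0) : L2) k‖
        ≤ |xi k| * T * (c * |h n|) ^ 2 :=
      ae_all_iff.2 fun n => (hv n).ae_norm_fourier_sub_le (hc n) ht
    have a2 : ∀ᵐ k, ∀ n, (𝓕 (v n 0) : L2) k = h n * (𝓕 f : L2) k := by
      refine ae_all_iff.2 fun n => ?_
      rw [hv0]
      exact ae_fourier_smul _ _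
    filter_upwards [a1, a2] with k k1 k2
    rw [tendsto_iff_norm_sub_tendsto_zero]
    have hlim : Tendsto (fun n => |h n| * (|xi k| * T * c ^ 2)) atTop (𝓝 0) := by
      simpa using hh0.abs.mul_const (|xi k| * T * c ^ 2)
    refine squeeze_zero (fun _ => norm_nonneg _) (fun n => ?_) hlim
    have hne : (h n : ℂ) ≠ 0 := by exact_mod_cast hh n
    have e : ((h n)⁻¹ : ℂ) * (𝓕 (v n t) : L2) k
        - Complex.exp (Complex.I * t * omega α k) * (𝓕 f : L2) k
        = ((h n)⁻¹ : ℂ) * ((𝓕 (v n t) : L2) k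
          - Complex.exp (Complex.I * t * omega α k) * (𝓕 (v n 0) : L2) k) := by
      rw [k2]
      field_simp
    rw [e, norm_mul, norm_inv, Complex.norm_real, Real.norm_eq_abs,
      inv_mul_le_iff₀ (abs_pos.2 (hh n))]
    refine (k1 n).trans (le_of_eq ?_)
    ring
  -- The Sobolev limit `χ` is not known in advance. Fatou's lemma, applied to differences that tend
  -- to zero in norm and converge pointwise, shows that it is the free evolution.
  have hGeq : ∀ᵐ k, weight s₁ s₂ k
      * (Complex.exp (Complex.I * t * omega α k) * (𝓕 f : L2) k) - G k = 0 := by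
    have hmeas : AEStronglyMeasurable (fun k => weight s₁ s₂ k
        * (Complex.exp (Complex.I * t * omega α k) * (𝓕 f : L2) k) - G k) := by
      have hw : Continuous fun k => (weight s₁ s₂ k : ℂ) := by
        have := continuous_weight s₁ s₂; fun_prop
      exact (hw.aestronglyMeasurable.mul (memLp_exp_mul α t (𝓕 f)).1).sub
        (Lp.aestronglyMeasurable _)
    refine (eLpNorm_eq_zero_iff (p := 2) hmeas (by norm_num)).1 ?_
    refine le_antisymm ?_ zero_le
    have hF := Lp.eLpNorm_lim_le_liminf_eLpNorm (p := 2) (μ := (volume : Measure Space))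
      (f := fun n k => (𝓕 (Sobolev.toL2 s₁ s₂ ((h n)⁻¹ • ψ n - χ)) : L2) k)
      (fun n => Lp.aestronglyMeasurable _) (fun k => weight s₁ s₂ k
        * (Complex.exp (Complex.I * t * omega α k) * (𝓕 f : L2) k) - G k) (by
        filter_upwards [hD, hpt] with k k1 k2
        simp_rw [k1]
        exact (k2.const_mul _).sub_const _)
    refine hF.trans (le_of_eq ?_)
    simp_rw [eLpNorm_fourier_eq, ← ofReal_norm, ← Sobolev.norm_def]
    have : Tendsto (fun n => ENNReal.ofReal ‖(h n)⁻¹ • ψ n - χ‖) atTop (𝓝 0) := by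
      simpa using ENNReal.tendsto_ofReal hD0
    exact this.liminf_eq
  rw [tendsto_iff_norm_sub_tendsto_zero]
  refine squeeze_zero (fun _ => norm_nonneg _) (fun n => ?_) hD0
  rw [Sobolev.norm_def, ← Lp.norm_fourier_eq, ← Lp.norm_fourier_eq (Sobolev.toL2 _ _ _),
    fourier_sub]
  apply Lp.norm_le_norm_of_ae_le
  filter_upwards [hD, hGeq, Lp.coeFn_sub (𝓕 (((h n)⁻¹ : ℂ) • v n t) : L2) (𝓕 (freeEvolution α f t)),
    ae_fourier_smul ((h n)⁻¹ : ℂ) (v n t), fourier_freeEvolution α f t] with k k1 k2 k3 k4 k5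
  rw [k1, k3, Pi.sub_apply, k4, k5, ← sub_eq_zero.1 k2, ← mul_sub, norm_mul, Complex.norm_real,
    Real.norm_of_nonneg (weight_pos _ _ _).le]
  exact le_mul_of_one_le_left (norm_nonneg _) (one_le_weight h₁ h₂ k)

/-- Both sign regimes only have to supply solutions of size `O(|h|)` in `L²` and their first-order
limit. For nonnegative exponents both come from the expansion of `Γ`; otherwise they come from
conservation of the `L²` norm, which is available because `h f` lies in `E^∞`. -/
theorem IsFlowMap.tendsto_second_order {α s₁ s₂ T K : ℝ} {U : Set (Sobolev s₁ s₂)}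
    {Γ : Sobolev s₁ s₂ → C(Icc (-T) T, Sobolev s₁ s₂)} (hΓ : IsFlowMap α s₁ s₂ T U Γ)
    {L : Sobolev s₁ s₂ →L[ℝ] C(Icc (-T) T, Sobolev s₁ s₂)} {φ : Sobolev s₁ s₂} {f : L2}
    (hφ : φ.toTempered = (f : Tempered)) (hf : MemEnergyInfty f)
    (hf1 : Integrable fun k => |xi k| * ‖(𝓕 f : L2) k‖)
    {h : ℕ → ℝ} (hh : ∀ n, h n ≠ 0) (hh0 : Tendsto h atTop (𝓝 0)) (hh1 : ∀ n, |h n| ≤ 1)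
    (hK : 0 ≤ K) (hU : ∀ n, h n • φ ∈ U)
    (hL : ∀ n, ‖Γ (h n • φ) - L (h n • φ)‖ ≤ K * ‖h n • φ‖ ^ 2)
    {t : ℝ} (ht : t ∈ Icc 0 T) (ht' : t ∈ Icc (-T) T) :
    ∀ᵐ k, Tendsto (fun n => ((h n)⁻¹ : ℂ) ^ 2 *
        ((𝓕 (Sobolev.toL2 s₁ s₂ (Γ (h n • φ) ⟨t, ht'⟩)) : L2) k
        - weight s₁ s₂ k *
          (Complex.exp (Complex.I * t * omega α k) * (h n * (𝓕 f : L2) k)))) atTop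
      (𝓝 (weight s₁ s₂ k *
        (Complex.exp (Complex.I * t * omega α k) * secondIterate α f t k))) := by
  have hT : -T ≤ 0 := by linarith [ht.1, ht.2]
  have hIcc : Icc 0 T ⊆ Icc (-T) T := Icc_subset_Icc hT le_rfl
  have hdata (n : ℕ) := Sobolev.toTempered_smul (h n) hφ
  suffices H : ∃ (v : ℕ → ℝ → L2) (c : ℝ), (∀ n, IsMildSolution α T (v n)) ∧
      (∀ n, v n 0 = (h n : ℂ) • f) ∧ (∀ n, ∀ s ∈ Icc 0 T, ‖v n s‖ ≤ c * |h n|) ∧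
      (∀ n, ∀ s : Icc (-T) T, (Γ (h n • φ) s).toTempered = (v n s : L2)) ∧
      ∀ s ∈ Icc 0 T, Tendsto (fun n => ((h n)⁻¹ : ℂ) • v n s) atTop
        (𝓝 (freeEvolution α f s)) by
    obtain ⟨v, c, hv, hv0, hc, hvΓ, hlim⟩ := H
    have e : ∀ᵐ k, ∀ n, (𝓕 (Sobolev.toL2 s₁ s₂ (Γ (h n • φ) ⟨t, ht'⟩)) : L2) k
        = weight s₁ s₂ k * (𝓕 (v n t) : L2) k :=
      ae_all_iff.2 fun n => Sobolev.fourier_toL2 _ (hvΓ n ⟨t, ht'⟩)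
    filter_upwards [KPI.tendsto_second_order hh hv hv0 hc hlim ht, e] with k k1 k2
    simp_rw [k2, ← mul_sub, mul_left_comm _ (weight s₁ s₂ k : ℂ)]
    exact k1.const_mul _
  by_cases hs : 0 ≤ s₁ ∧ 0 ≤ s₂
  · choose v hv hv0 hvΓ using fun n => hΓ.mild hs.1 hs.2 (h n • φ) (hU n)
    have hv0' (n : ℕ) : v n 0 = (h n : ℂ) • f := by
      apply coe_injective
      rw [← hv0, hdata]
    have hnorm (n : ℕ) : ‖Γ (h n • φ)‖ ≤ (‖L‖ * ‖φ‖ + K * ‖φ‖ ^ 2) * |h n| := by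
      calc ‖Γ (h n • φ)‖ = ‖(Γ (h n • φ) - L (h n • φ)) + L (h n • φ)‖ := by
            rw [sub_add_cancel]
        _ ≤ K * ‖h n • φ‖ ^ 2 + ‖L‖ * ‖h n • φ‖ :=
            (norm_add_le _ _).trans (add_le_add (hL n) (L.le_opNorm _))
        _ = (‖L‖ * ‖φ‖ + K * ‖φ‖ ^ 2 * |h n|) * |h n| := by
            rw [norm_smul, Real.norm_eq_abs]; ring
        _ ≤ (‖L‖ * ‖φ‖ + K * ‖φ‖ ^ 2 * 1) * |h n| := by
            gcongr
            exact hh1 n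
        _ = _ := by rw [mul_one]
    have hc (n : ℕ) (s : ℝ) (hs' : s ∈ Icc 0 T) :
        ‖v n s‖ ≤ (‖L‖ * ‖φ‖ + K * ‖φ‖ ^ 2) * |h n| := by
      refine le_trans ?_ ((ContinuousMap.norm_coe_le_norm (Γ (h n • φ)) ⟨s, hIcc hs'⟩).trans
        (hnorm n))
      rw [Sobolev.norm_def, ← Lp.norm_fourier_eq, ← Lp.norm_fourier_eq (Sobolev.toL2 _ _ _)]
      apply Lp.norm_le_norm_of_ae_le
      filter_upwards [Sobolev.fourier_toL2 _ (hvΓ n ⟨s, hIcc hs'⟩)] with k hk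
      rw [hk, norm_mul, Complex.norm_real, Real.norm_of_nonneg (weight_pos _ _ _).le]
      exact le_mul_of_one_le_left (norm_nonneg _) (one_le_weight hs.1 hs.2 k)
    refine ⟨v, _, hv, hv0', hc, hvΓ, fun s hs' => ?_⟩
    refine tendsto_freeEvolution_of_differentiable hs.1 hs.2 hh hh0 hv hv0' hc hs'
      (fun n => hvΓ n ⟨s, hIcc hs'⟩) (χ := L φ ⟨s, hIcc hs'⟩) ?_
    rw [tendsto_iff_norm_sub_tendsto_zero]
    have hlim : Tendsto (fun n => |h n| * (K * ‖φ‖ ^ 2)) atTop (𝓝 0) := by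
      simpa using hh0.abs.mul_const (K * ‖φ‖ ^ 2)
    refine squeeze_zero (fun _ => norm_nonneg _) (fun n => ?_) hlim
    have e : (h n)⁻¹ • Γ (h n • φ) ⟨s, hIcc hs'⟩ - L φ ⟨s, hIcc hs'⟩
        = (h n)⁻¹ • (Γ (h n • φ) - L (h n • φ)) ⟨s, hIcc hs'⟩ := by
      rw [map_smul, ContinuousMap.sub_apply, ContinuousMap.smul_apply, smul_sub, smul_smul,
        inv_mul_cancel₀ (hh n), one_smul]
    rw [e, norm_smul, norm_inv, Real.norm_eq_abs, inv_mul_le_iff₀ (abs_pos.2 (hh n))]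
    refine ((ContinuousMap.norm_coe_le_norm _ _).trans (hL n)).trans (le_of_eq ?_)
    rw [norm_smul, Real.norm_eq_abs]
    ring
  · have hneg : s₁ < 0 ∨ s₂ < 0 := by
      rw [not_and_or, not_le, not_le] at hs
      exact hs
    choose v hv hvE hv0 hvΓ using fun n =>
      hΓ.regular hneg (h n • φ) (hU n) ((h n : ℂ) • f) (hdata n) (hf.smul _)
    have hcons (n : ℕ) (s : ℝ) (hs' : s ∈ Icc 0 T) : ‖v n s‖ = ‖v n 0‖ := by
      refine norm_eq_of_regular (hv n) (hvE n) (fun r hr => ?_) hs'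
      rw [← hvΓ n ⟨r, hr⟩]
      exact Sobolev.isRealValued_toTempered _
    refine ⟨v, ‖f‖, hv, hv0, fun n s hs' => ?_, hvΓ, fun s hs' => ?_⟩
    · rw [hcons n s hs', hv0, norm_smul, Complex.norm_real, Real.norm_eq_abs, mul_comm]
    · exact tendsto_freeEvolution_of_norm_eq hf1 hh hh0 hv hv0 hcons hs'

/-- A flow map which is twice continuously differentiable at the origin bounds the second
Picard iterate. -/
theorem IsFlowMap.exists_secondIterate_le {α s₁ s₂ T : ℝ} {U : Set (Sobolev s₁ s₂)}
    {Γ : Sobolev s₁ s₂ → C(Icc (-T) T, Sobolev s₁ s₂)} (hΓ : IsFlowMap α s₁ s₂ T U Γ)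
    (hC2 : ContDiffAt ℝ 2 Γ 0) :
    ∃ C : ℝ, 0 ≤ C ∧ ∀ f : L2, IsRealValued (f : Tempered) → MemEnergyInfty f →
      Integrable (fun k => |xi k| * ‖(𝓕 f : L2) k‖) →
      MemLp (fun k => (weight s₁ s₂ k : ℂ) * (𝓕 f : L2) k) 2 volume → ∀ t ∈ Icc 0 T,
      eLpNorm (fun k => (weight s₁ s₂ k : ℂ) * secondIterate α f t k) 2 volume ≤
        ENNReal.ofReal C *
          eLpNorm (fun k => (weight s₁ s₂ k : ℂ) * (𝓕 f : L2) k) 2 volume ^ 2 := by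
  obtain ⟨L, K, hK, hev⟩ := ContDiffAt.exists_sub_le_sq hC2 hΓ.map_zero
  refine ⟨K, hK, fun f hr hE hf1 hm t ht => ?_⟩
  have ht' : t ∈ Icc (-T) T := ⟨by linarith [ht.1, ht.2], ht.2⟩
  set φ : Sobolev s₁ s₂ := Sobolev.ofL2 f hr hm
  have hφ : φ.toTempered = (f : Tempered) := rfl
  have hcont : Tendsto (fun h : ℝ => h • φ) (𝓝 0) (𝓝 0) := by
    have : Continuous fun h : ℝ => h • φ := by fun_prop
    simpa using this.tendsto 0
  obtain ⟨δ, hδ, hball⟩ := Metric.eventually_nhds_iff.1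
    (hcont.eventually (hev.and (show ∀ᶠ x in 𝓝 0, x ∈ U from hΓ.nhds_zero)))
  -- The cap `δ / 2` keeps both `h φ` and `-h φ` in the region where the expansion holds and the
  -- data lie in `U`.
  set h : ℕ → ℝ := fun n => min 1 (δ / 2) / (n + 1) with hhdef
  have hpos (n : ℕ) : 0 < h n := by positivity
  have hle (n : ℕ) : h n ≤ min 1 (δ / 2) := div_le_self (by positivity) (by simp)
  have hh0 : Tendsto h atTop (𝓝 0) := by
    have := (tendsto_one_div_add_atTop_nhds_zero_nat (𝕜 := ℝ)).const_mul (min 1 (δ / 2))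
    simpa [hhdef, div_eq_mul_inv] using this
  have hgood (n : ℕ) (ε : ℝ) (hε : |ε| = h n) :
      ‖Γ (ε • φ) - L (ε • φ)‖ ≤ K * ‖ε • φ‖ ^ 2 ∧ ε • φ ∈ U := by
    apply hball
    rw [Real.dist_eq, sub_zero, hε]
    linarith [hle n, min_le_right 1 (δ / 2)]
  have habs (n : ℕ) : |h n| = h n := abs_of_pos (hpos n)
  have habs' (n : ℕ) : |-h n| = h n := by rw [abs_neg, habs]
  have p := hΓ.tendsto_second_order hφ hE hf1 (h := h) (fun n => (hpos n).ne') hh0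
    (fun n => by rw [habs]; exact (hle n).trans (min_le_left _ _)) hK
    (fun n => (hgood n _ (habs n)).2) (fun n => (hgood n _ (habs n)).1) ht ht'
  have q := hΓ.tendsto_second_order hφ hE hf1 (h := fun n => -h n)
    (fun n => neg_ne_zero.2 (hpos n).ne') (by simpa using hh0.neg)
    (fun n => by rw [habs']; exact (hle n).trans (min_le_left _ _)) hK
    (fun n => (hgood n _ (habs' n)).2) (fun n => (hgood n _ (habs' n)).1) ht ht'
  -- The symmetric second difference: the linear term `L` cancels here, and the free evolution
  -- cancels in the sum of the limits `p` and `q`.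
  let ψ : ℕ → Sobolev s₁ s₂ := fun n =>
    ((h n)⁻¹ ^ 2 / 2) • (Γ (h n • φ) + Γ (-h n • φ)) ⟨t, ht'⟩
  have hψ (n : ℕ) : ‖ψ n‖ ≤ K * ‖φ‖ ^ 2 := by
    have e1 : ‖Γ (h n • φ) + Γ (-h n • φ)‖ ≤ 2 * (K * (h n ^ 2 * ‖φ‖ ^ 2)) := by
      have e2 : Γ (h n • φ) + Γ (-h n • φ) = (Γ (h n • φ) - L (h n • φ))
          + (Γ (-h n • φ) - L (-h n • φ)) := by
        rw [neg_smul, map_neg]; abel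
      have e3 := (hgood n _ (habs n)).1
      have e4 := (hgood n _ (habs' n)).1
      rw [norm_smul, Real.norm_eq_abs, habs, mul_pow] at e3
      rw [norm_smul, Real.norm_eq_abs, habs', mul_pow] at e4
      rw [e2]
      refine (norm_add_le _ _).trans ?_
      linarith
    have e5 := (ContinuousMap.norm_coe_le_norm (Γ (h n • φ) + Γ (-h n • φ)) ⟨t, ht'⟩).trans e1
    simp only [ψ]
    rw [norm_smul, Real.norm_of_nonneg (by have := hpos n; positivity)]
    have := hpos n
    calc _ ≤ (h n)⁻¹ ^ 2 / 2 * (2 * (K * (h n ^ 2 * ‖φ‖ ^ 2))) := by gcongr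
      _ = _ := by field_simp
  have hlim : ∀ᵐ k, Tendsto (fun n => (𝓕 (Sobolev.toL2 s₁ s₂ (ψ n)) : L2) k) atTop
      (𝓝 (weight s₁ s₂ k *
        (Complex.exp (Complex.I * t * omega α k) * secondIterate α f t k))) := by
    have e : ∀ᵐ k, ∀ n, (𝓕 (Sobolev.toL2 s₁ s₂ (ψ n)) : L2) k = (((h n)⁻¹ ^ 2 / 2 : ℝ) : ℂ) *
        ((𝓕 (Sobolev.toL2 s₁ s₂ (Γ (h n • φ) ⟨t, ht'⟩)) : L2) k
        + (𝓕 (Sobolev.toL2 s₁ s₂ (Γ (-h n • φ) ⟨t, ht'⟩)) : L2) k) := by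
      refine ae_all_iff.2 fun n => ?_
      have e1 : Sobolev.toL2 s₁ s₂ (ψ n) = (((h n)⁻¹ ^ 2 / 2 : ℝ) : ℂ) •
          (Sobolev.toL2 s₁ s₂ (Γ (h n • φ) ⟨t, ht'⟩)
            + Sobolev.toL2 s₁ s₂ (Γ (-h n • φ) ⟨t, ht'⟩)) := by
        simp only [ψ]
        rw [map_smul, ContinuousMap.add_apply, map_add]
        exact (Complex.coe_smul _ _).symm
      rw [e1]
      have e2 : 𝓕 (Sobolev.toL2 s₁ s₂ (Γ (h n • φ) ⟨t, ht'⟩)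
            + Sobolev.toL2 s₁ s₂ (Γ (-h n • φ) ⟨t, ht'⟩))
          = (𝓕 (Sobolev.toL2 s₁ s₂ (Γ (h n • φ) ⟨t, ht'⟩)) : L2)
            + 𝓕 (Sobolev.toL2 s₁ s₂ (Γ (-h n • φ) ⟨t, ht'⟩)) :=
        map_add (Lp.fourierTransformₗᵢ Space ℂ) _ _
      filter_upwards [ae_fourier_smul (((h n)⁻¹ ^ 2 / 2 : ℝ) : ℂ)
        (Sobolev.toL2 s₁ s₂ (Γ (h n • φ) ⟨t, ht'⟩) + Sobolev.toL2 s₁ s₂ (Γ (-h n • φ) ⟨t, ht'⟩)),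
        Lp.coeFn_add (𝓕 (Sobolev.toL2 s₁ s₂ (Γ (h n • φ) ⟨t, ht'⟩)) : L2)
          (𝓕 (Sobolev.toL2 s₁ s₂ (Γ (-h n • φ) ⟨t, ht'⟩)))] with k k1 k2
      rw [k1, e2, k2, Pi.add_apply]
    filter_upwards [p, q, e] with k k1 k2 k3
    have := (k1.add k2).const_mul (1 / 2 : ℂ)
    convert! this using 2 with n
    · rw [k3]
      push_cast
      rw [inv_neg, neg_sq]
      ring
    · ring
  have hF := Lp.eLpNorm_lim_le_liminf_eLpNorm (p := 2) (μ := (volume : Measure Space))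
    (fun n => Lp.aestronglyMeasurable (𝓕 (Sobolev.toL2 s₁ s₂ (ψ n)) : L2)) _ hlim
  have hleft : eLpNorm (fun k => (weight s₁ s₂ k : ℂ) * secondIterate α f t k) 2 volume
      = eLpNorm (fun k => (weight s₁ s₂ k : ℂ) *
        (Complex.exp (Complex.I * t * omega α k) * secondIterate α f t k)) 2 volume := by
    apply eLpNorm_congr_norm_ae
    refine ae_of_all _ fun k => ?_
    rw [norm_mul, norm_mul, norm_mul, norm_exp_I_mul, one_mul]
  rw [hleft, ← Sobolev.enorm_eq φ hφ]
  refine hF.trans (liminf_le_of_frequently_le' (Eventually.of_forall fun n => ?_).frequently)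
  rw [eLpNorm_fourier_eq, ← ofReal_norm, ← Sobolev.norm_def, ← ofReal_norm φ,
    ← ENNReal.ofReal_pow (norm_nonneg _), ← ENNReal.ofReal_mul hK]
  exact ENNReal.ofReal_le_ofReal (hψ n)


/-! ### Data with prescribed frequency support -/

/-- Dividing out the weight makes the weighted transform the indicator of `D`, so the squared norm
is the volume of `D`. Symmetry of `D` makes the datum real. Compactness of `D` and its distance from
`ξ = 0` bound every energy weight on it. -/
theorem exists_datum (s₁ s₂ : ℝ) {D : Set Space} (hD : IsCompact D) (hneg : ∀ k ∈ D, -k ∈ D)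
    (hxi : ∀ k ∈ D, xi k ≠ 0) :
    ∃ f : L2, (∀ᵐ k, (𝓕 f : L2) k = ((D.indicator (fun k => (weight s₁ s₂ k)⁻¹) k : ℝ) : ℂ)) ∧
      IsRealValued (f : Tempered) ∧ MemEnergyInfty f ∧
      Integrable (fun k => |xi k| * ‖(𝓕 f : L2) k‖) ∧
      MemLp (fun k => (weight s₁ s₂ k : ℂ) * (𝓕 f : L2) k) 2 volume ∧
      eLpNorm (fun k => (weight s₁ s₂ k : ℂ) * (𝓕 f : L2) k) 2 volume ^ 2 = volume D := by
  have hw := continuous_weight s₁ s₂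
  have hwi : ContinuousOn (fun k => (weight s₁ s₂ k)⁻¹) D :=
    hw.continuousOn.inv₀ fun k _ => (weight_pos s₁ s₂ k).ne'
  have key {h : Space → ℝ} (hh : ContinuousOn h D) (p : ENNReal) (hp : p ≠ ⊤) :
      MemLp (fun k => ((D.indicator h k : ℝ) : ℂ)) p volume := by
    have hred : MemLp (D.indicator h) p volume →
        MemLp (fun k => ((D.indicator h k : ℝ) : ℂ)) p volume := fun hh => hh.ofReal
    refine hred ((memLp_indicator_iff_restrict hD.measurableSet).2 ?_)
    obtain ⟨C, hC⟩ := hD.exists_bound_of_continuousOn hh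
    have : IsFiniteMeasure (volume.restrict D) := ⟨by simpa using hD.measure_lt_top⟩
    exact MemLp.of_bound (hh.aestronglyMeasurable hD.measurableSet) C
      ((ae_restrict_iff' hD.measurableSet).2 (ae_of_all _ hC))
  have hg := key hwi 2 (by norm_num)
  set f : L2 := 𝓕⁻ hg.toLp with hf
  have hfg : ∀ᵐ k, (𝓕 f : L2) k = ((D.indicator (fun k => (weight s₁ s₂ k)⁻¹) k : ℝ) : ℂ) := by
    rw [hf, fourier_fourierInv_eq]
    exact hg.coeFn_toLp
  have hone : (fun k => (weight s₁ s₂ k : ℂ) * (𝓕 f : L2) k) =ᵐ[volume]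
      fun k => ((D.indicator (fun _ => (1 : ℝ)) k : ℝ) : ℂ) := by
    filter_upwards [hfg] with k hk
    rw [hk]
    by_cases h : k ∈ D
    · have := (weight_pos s₁ s₂ k).ne'
      simp only [indicator_of_mem h]
      rw [← Complex.ofReal_mul, mul_inv_cancel₀ this]
    · simp [h]
  refine ⟨f, hfg, isRealValued_of_fourier_neg ?_, fun σ _ => ?_, ?_, ?_, ?_⟩
  · filter_upwards [hfg, (Measure.measurePreserving_neg
      (volume : Measure Space)).quasiMeasurePreserving.ae hfg] with k h1 h2
    rw [h2, h1, Complex.conj_ofReal]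
    congr 1
    by_cases h : k ∈ D
    · rw [indicator_of_mem h, indicator_of_mem (hneg k h), weight_neg_arg]
    · have h' : -k ∉ D := fun h' => h (by simpa using hneg _ h')
      rw [indicator_of_notMem h, indicator_of_notMem h']
  · have hc : ContinuousOn (fun k => (1 + xi k ^ 2) ^ (σ / 2) * (1 + √(etaSq k) / |xi k|)
        * (weight s₁ s₂ k)⁻¹) D := by
      refine ContinuousOn.mul (ContinuousOn.mul ?_ ?_) hwi
      · refine ContinuousOn.rpow_const ?_ fun k _ => Or.inl (by positivity)
        have := continuous_xi
        fun_prop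
      · refine continuousOn_const.add (ContinuousOn.div ?_ ?_ fun k hk => abs_ne_zero.2 (hxi k hk))
        · exact (continuous_etaSq.sqrt).continuousOn
        · exact continuous_xi.abs.continuousOn
    have := (key hc 2 (by norm_num)).2
    refine lt_of_eq_of_lt (eLpNorm_congr_ae ?_) this
    filter_upwards [hfg] with k hk
    rw [hk, ← Complex.ofReal_mul]
    congr 1
    by_cases h : k ∈ D
    · simp only [indicator_of_mem h]
    · simp [h]
  · have hc : ContinuousOn (fun k => |xi k| * (weight s₁ s₂ k)⁻¹) D :=
      continuous_xi.abs.continuousOn.mul hwi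
    have := (memLp_one_iff_integrable.1 (key hc 1 (by norm_num))).norm
    refine this.congr ?_
    filter_upwards [hfg] with k hk
    rw [hk]
    by_cases h : k ∈ D
    · simp [h]
    · simp [h]
  · exact (memLp_congr_ae hone).2 (key continuousOn_const 2 (by norm_num))
  · rw [eLpNorm_congr_ae hone]
    have : (fun k => ((D.indicator (fun _ => (1 : ℝ)) k : ℝ) : ℂ))
        = D.indicator fun _ => (1 : ℂ) := by
      ext k
      by_cases h : k ∈ D <;> simp [h]
    rw [this, eLpNorm_indicator_const hD.measurableSet (by norm_num) (by norm_num),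
      ← ENNReal.rpow_natCast, ENNReal.mul_rpow_of_nonneg _ _ (by norm_num), ← ENNReal.rpow_mul]
    simp

/-! ### A lower bound for the second iterate -/

theorem integrable_mul_reflected {f : L2} {g : Space → ℝ}
    (hfg : ∀ᵐ k, (𝓕 f : L2) k = (g k : ℂ)) (k : Space) : Integrable fun l => g l * g (k - l) := by
  have hfg' := (Measure.measurePreserving_sub_left volume k).quasiMeasurePreserving.ae hfg
  have h1 := (memLp_coe (𝓕 f)).integrable_mul
    ((memLp_coe (𝓕 f)).comp_measurePreserving (Measure.measurePreserving_sub_left volume k))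
  have h2 : Integrable fun l => ((g l * g (k - l) : ℝ) : ℂ) := by
    refine h1.congr ?_
    filter_upwards [hfg, hfg'] with l k1 k2
    simp only [Pi.mul_apply, Function.comp_apply, k1, k2, Complex.ofReal_mul]
  exact h2.re

/-- While the phase `sΩ` stays within `[-1, 1]`, its cosine is at least `1/2`. Since `g` is
nonnegative, no cancellation is possible, and the real part of the time integral retains half of the
full convolution. -/
theorem le_norm_secondIterate {α t : ℝ} (ht : 0 ≤ t) {f : L2} {g : Space → ℝ}
    (hg : ∀ k, 0 ≤ g k) (hfg : ∀ᵐ k, (𝓕 f : L2) k = (g k : ℂ)) {k : Space}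
    (hΩ : ∀ l, g l ≠ 0 → g (k - l) ≠ 0 → |omega α l + omega α (k - l) - omega α k| * t ≤ 1) :
    |xi k| * (t / 2 * ∫ l, g l * g (k - l)) ≤ ‖secondIterate α f t k‖ := by
  set Ω : Space → ℝ := fun l => omega α l + omega α (k - l) - omega α k with hΩdef
  set G : Space → ℝ := fun l => g l * g (k - l) with hG
  have hG0 (l : Space) : 0 ≤ G l := mul_nonneg (hg _) (hg _)
  have hfg' := (Measure.measurePreserving_sub_left volume k).quasiMeasurePreserving.ae hfg
  have hGint : Integrable G := integrable_mul_reflected hfg k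
  have hΩm : Measurable Ω := by
    have := measurable_omega α
    fun_prop
  set Ψ : ℝ → ℂ := fun s => ∫ l, Complex.exp (Complex.I * s * Ω l) * G l with hΨ
  have hmeas (s : ℝ) : AEStronglyMeasurable
      (fun l => Complex.exp (Complex.I * s * Ω l) * (G l : ℂ)) :=
    AEStronglyMeasurable.mul (Measurable.aestronglyMeasurable (by fun_prop)) (Complex.continuous_ofReal.comp_aestronglyMeasurable hGint.1)
  have hnorm (s : ℝ) (l : Space) : ‖Complex.exp (Complex.I * s * Ω l) * (G l : ℂ)‖ = G l := by
    rw [norm_mul, norm_exp_I_mul, one_mul, Complex.norm_real, Real.norm_of_nonneg (hG0 l)]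
  have hint (s : ℝ) : Integrable (fun l => Complex.exp (Complex.I * s * Ω l) * (G l : ℂ)) :=
    hGint.mono' (hmeas s) (ae_of_all _ fun l => (hnorm s l).le)
  have hΨc : Continuous Ψ := by
    refine continuous_of_dominated (bound := G) hmeas (fun s => ae_of_all _ fun l => (hnorm s l).le)
      hGint (ae_of_all _ fun l => ?_)
    fun_prop
  have hforce (s : ℝ) : forcing α (freeEvolution α f) s k = Complex.I * xi k * Ψ s := by
    rw [forcing, fourierSq_eq_convolution, mul_left_comm, ← integral_const_mul]
    congr 1
    apply integral_congr_ae
    have e := fourier_freeEvolution α f s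
    have e' := (Measure.measurePreserving_sub_left volume k).quasiMeasurePreserving.ae e
    filter_upwards [e, e', hfg, hfg'] with l k1 k2 k3 k4
    rw [k1, k2, k3, k4]
    have : Complex.exp (Complex.I * s * Ω l) = Complex.exp (-(Complex.I * s * omega α k))
        * (Complex.exp (Complex.I * s * omega α l)
          * Complex.exp (Complex.I * s * omega α (k - l))) := by
      rw [← Complex.exp_add, ← Complex.exp_add]
      congr 1
      simp only [hΩdef]
      push_cast
      ring
    rw [this, hG]
    push_cast
    ring
  have hre {s : ℝ} (hs : s ∈ Icc 0 t) : 1 / 2 * ∫ l, G l ≤ (Ψ s).re := by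
    have e : (Ψ s).re = ∫ l, Real.cos (s * Ω l) * G l := by
      have := integral_re (𝕜 := ℂ) (hint s)
      simp only [RCLike.re_to_complex] at this
      rw [hΨ, ← this]
      congr 1
      ext l
      rw [show Complex.I * s * Ω l = ((s * Ω l : ℝ) : ℂ) * Complex.I by push_cast; ring,
        Complex.re_mul_ofReal, Complex.exp_ofReal_mul_I_re]
    rw [e, ← integral_const_mul]
    refine integral_mono_of_nonneg (ae_of_all _ fun l => by have := hG0 l; positivity) ?_
      (ae_of_all _ fun l => ?_)
    · refine hGint.mono' ?_ (ae_of_all _ fun l => ?_)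
      · exact AEStronglyMeasurable.mul (Measurable.aestronglyMeasurable (by fun_prop)) hGint.1
      · rw [norm_mul, Real.norm_of_nonneg (hG0 l)]
        exact mul_le_of_le_one_left (hG0 l) (Real.abs_cos_le_one _)
    · by_cases h0 : G l = 0
      · simp [h0]
      · have h1 := hΩ l (left_ne_zero_of_mul h0) (right_ne_zero_of_mul h0)
        have h2 : |s * Ω l| ≤ 1 := by
          rw [abs_mul, abs_of_nonneg hs.1, mul_comm]
          exact (mul_le_mul_of_nonneg_left hs.2 (abs_nonneg _)).trans h1
        have h3 := Real.one_sub_sq_div_two_le_cos (x := s * Ω l)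
        have h4 : (s * Ω l) ^ 2 ≤ 1 := by
          rw [← sq_abs]
          exact pow_le_one₀ (abs_nonneg _) h2
        refine mul_le_mul_of_nonneg_right ?_ (hG0 l)
        linarith
  have hsec : secondIterate α f t k = Complex.I * xi k * ∫ s in (0 : ℝ)..t, Ψ s := by
    rw [secondIterate, ← intervalIntegral.integral_const_mul]
    congr 1
    ext s
    exact hforce s
  rw [hsec, norm_mul, norm_mul, Complex.norm_I, one_mul, Complex.norm_real, Real.norm_eq_abs]
  refine mul_le_mul_of_nonneg_left (le_trans ?_ (Complex.re_le_norm _)) (abs_nonneg _)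
  have e1 : (∫ s in (0 : ℝ)..t, Ψ s).re = ∫ s in (0 : ℝ)..t, (Ψ s).re :=
    (Complex.reCLM.intervalIntegral_comp_comm (hΨc.intervalIntegrable 0 t)).symm
  have e2 : t / 2 * ∫ l, G l = ∫ s in (0 : ℝ)..t, (1 / 2 * ∫ l, G l) := by
    rw [intervalIntegral.integral_const, smul_eq_mul]
    ring
  rw [e1, e2]
  refine intervalIntegral.integral_mono_on ht (by simp) ?_ fun s hs => hre hs
  exact (Complex.continuous_re.comp hΨc).intervalIntegrable _ _

/-! ### Comparison of weights -/

theorem rpow_le_mul_rpow {A B Q : ℝ} (hA : 0 < A) (hB : 0 < B) (hQ : 1 ≤ Q) (h1 : A ≤ Q * B)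
    (h2 : B ≤ Q * A) (s : ℝ) : A ^ s ≤ Q ^ |s| * B ^ s := by
  rcases le_total 0 s with hs | hs
  · rw [abs_of_nonneg hs, ← Real.mul_rpow (by positivity) hB.le]
    exact Real.rpow_le_rpow hA.le h1 hs
  · rw [abs_of_nonpos hs, Real.rpow_neg (by positivity), ← Real.inv_rpow (by positivity),
      ← Real.mul_rpow (by positivity) hB.le]
    refine Real.rpow_le_rpow_of_nonpos (by positivity) ?_ hs
    rw [inv_mul_le_iff₀ (by positivity)]
    exact h2

/-- A shift of length at most `2` changes `1 + |z|²` by at most the factor `10`, as `1 + |z|² ≤ 1 +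
2|w|² + 8`. The comparison is needed in both directions because the exponents may be negative. -/
theorem weight_le_mul_weight (s₁ s₂ : ℝ) {k l : Space} (h1 : xi (k - l) ^ 2 ≤ 4)
    (h2 : etaSq (k - l) ≤ 4) :
    weight s₁ s₂ l ≤ 10 ^ |s₁ / 2| * 10 ^ |s₂ / 2| * weight s₁ s₂ k := by
  have hk := etaSq_nonneg k
  have hl := etaSq_nonneg l
  have e1 : xi (k - l) = xi k - xi l := by rw [sub_eq_add_neg, xi_add, xi_neg, sub_eq_add_neg]
  rw [e1] at h1
  have e2 : etaSq (k - l) = (2 * Real.pi * k 1 - 2 * Real.pi * l 1) ^ 2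
      + (2 * Real.pi * k 2 - 2 * Real.pi * l 2) ^ 2 := by
    simp only [etaSq, PiLp.sub_apply]; ring
  rw [e2] at h2
  have a1 := rpow_le_mul_rpow (A := 1 + xi l ^ 2) (B := 1 + xi k ^ 2) (Q := 10) (by positivity)
    (by positivity) (by norm_num) (by nlinarith [sq_nonneg (xi k - (xi k - xi l))])
    (by nlinarith [sq_nonneg (xi l + (xi k - xi l)), sq_nonneg (xi l - (xi k - xi l))]) (s₁ / 2)
  have a2 := rpow_le_mul_rpow (A := 1 + etaSq l) (B := 1 + etaSq k) (Q := 10) (by positivity)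
    (by positivity) (by norm_num)
    (by
      unfold etaSq
      set a := 2 * Real.pi * k 1
      set b := 2 * Real.pi * k 2
      set c := 2 * Real.pi * l 1
      set d := 2 * Real.pi * l 2
      nlinarith [sq_nonneg (a + (a - c)), sq_nonneg (b + (b - d))])
    (by
      unfold etaSq
      set a := 2 * Real.pi * k 1
      set b := 2 * Real.pi * k 2
      set c := 2 * Real.pi * l 1
      set d := 2 * Real.pi * l 2
      nlinarith [sq_nonneg (c - (a - c)), sq_nonneg (d - (b - d))]) (s₂ / 2)
  unfold weight
  calc _ ≤ (10 ^ |s₁ / 2| * (1 + xi k ^ 2) ^ (s₁ / 2))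
        * (10 ^ |s₂ / 2| * (1 + etaSq k) ^ (s₂ / 2)) := by gcongr
    _ = _ := by ring

theorem weight_zero (s₁ s₂ : ℝ) : weight s₁ s₂ 0 = 1 := by
  simp [weight, xi, etaSq]



/-! ### The resonance function -/

/-- The deviation of the longitudinal slope difference from `M`. -/
theorem abs_mul_slope_sub_le {N M γ γ₁ x₁ x₂ p₁ q₁ : ℝ} (hN : 10 ≤ N) (hγ : 0 < γ)
    (hγ' : γ ≤ 1) (hM : 0 ≤ M) (hγ₁ : 0 ≤ γ₁) (hx₁ : |x₁ - N| ≤ γ) (hx₂ : γ ≤ x₂)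
    (hx₂' : x₂ ≤ 2 * γ) (hp₁ : |p₁ - M * N| ≤ γ₁) (hq₁ : |q₁| ≤ γ₁) :
    |x₂ * (p₁ / x₁ - q₁ / x₂ - M)| ≤ 4 * γ * (γ₁ + M * γ) / N + γ₁ := by
  have hx₁' := abs_le.1 hx₁
  have hx10 : 0 < x₁ := by linarith
  have hx20 : 0 < x₂ := by linarith
  have e : x₂ * (p₁ / x₁ - q₁ / x₂ - M) = x₂ * ((p₁ - M * N) - M * (x₁ - N)) / x₁ - q₁ := by
    field_simp
    ring
  rw [e]
  refine (abs_sub _ _).trans (add_le_add ?_ hq₁)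
  rw [abs_div, abs_mul, abs_of_pos hx20, abs_of_pos hx10, div_le_div_iff₀ hx10 (by linarith)]
  have h1 : |(p₁ - M * N) - M * (x₁ - N)| ≤ γ₁ + M * γ := by
    refine (abs_sub _ _).trans (add_le_add hp₁ ?_)
    rw [abs_mul, abs_of_nonneg hM]
    gcongr
  have h2 : 0 ≤ γ₁ + M * γ := by positivity
  calc x₂ * |(p₁ - M * N) - M * (x₁ - N)| * N ≤ 2 * γ * (γ₁ + M * γ) * (2 * x₁) := by
        gcongr
        linarith
    _ = _ := by ring

/-- Controls the cross term `2Mδ` in the square expanded around slope `M`. This is where `M²γ² ≲ N`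
and `Mγ₁ ≲ 1` are forced on the boxes. -/
theorem mul_slope_bound_le {N M γ γ₁ c : ℝ} (hN : 10 ≤ N)
    (hγ' : γ ≤ 1) (hM : 0 ≤ M) (hc : 1 ≤ c) (hγ₁ : 0 ≤ γ₁) (hM1 : M ^ 2 * γ ^ 2 ≤ c * N)
    (hM2 : M * γ₁ ≤ c) : M * (4 * γ * (γ₁ + M * γ) / N + γ₁) ≤ 9 * c := by
  have hN0 : 0 < N := by linarith
  have h1 : γ * (M * γ₁) ≤ c * N := by
    calc γ * (M * γ₁) ≤ 1 * c := by gcongr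
      _ ≤ c * N := by nlinarith
  have h2 : (4 * (γ * (M * γ₁)) + 4 * (M ^ 2 * γ ^ 2)) / N ≤ 8 * c := by
    rw [div_le_iff₀ hN0]
    linarith
  calc M * (4 * γ * (γ₁ + M * γ) / N + γ₁)
      = (4 * (γ * (M * γ₁)) + 4 * (M ^ 2 * γ ^ 2)) / N + M * γ₁ := by ring
    _ ≤ 8 * c + c := add_le_add h2 hM2
    _ = 9 * c := by ring

theorem slope_bound_sq_le {N M γ γ₁ c : ℝ} (hN : 10 ≤ N) (hγ : 0 < γ)
    (hγ' : γ ≤ 1) (hM : 0 ≤ M) (hc : 1 ≤ c) (hγ₁ : 0 ≤ γ₁) (hM1 : M ^ 2 * γ ^ 2 ≤ c * N)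
    (hγ₁γ : γ₁ ^ 2 ≤ γ) : (4 * γ * (γ₁ + M * γ) / N + γ₁) ^ 2 ≤ 100 * c * γ := by
  have hN0 : 0 < N := by linarith
  set w := 4 * (M * γ ^ 2) / N with hw
  have u0 : 0 ≤ w := by positivity
  have u1 : 4 * γ * (γ₁ + M * γ) / N + γ₁ ≤ 2 * γ₁ + w := by
    have h1 : 4 * γ * γ₁ / N ≤ γ₁ := by
      rw [div_le_iff₀ hN0, mul_comm γ₁]
      gcongr
      linarith
    have h2 : 4 * γ * (γ₁ + M * γ) / N = 4 * γ * γ₁ / N + w := by rw [hw]; ring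
    linarith
  have u2 : w ^ 2 ≤ 16 * c * γ := by
    have h1 : w ^ 2 = 16 * (M ^ 2 * γ ^ 2) * γ ^ 2 / N ^ 2 := by rw [hw]; ring
    have h2 : N * γ ≤ N ^ 2 := by nlinarith
    rw [h1, div_le_iff₀ (by positivity)]
    calc 16 * (M ^ 2 * γ ^ 2) * γ ^ 2 ≤ 16 * (c * N) * γ ^ 2 := by gcongr
      _ = 16 * c * γ * (N * γ) := by ring
      _ ≤ 16 * c * γ * N ^ 2 := by gcongr
  have u3 : 0 ≤ 4 * γ * (γ₁ + M * γ) / N + γ₁ := by positivity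
  have u4 : γ ≤ c * γ := le_mul_of_one_le_left hγ.le hc
  calc (4 * γ * (γ₁ + M * γ) / N + γ₁) ^ 2 ≤ (2 * γ₁ + w) ^ 2 := by gcongr
    _ ≤ 8 * γ₁ ^ 2 + 2 * w ^ 2 := by linarith [sq_nonneg (2 * γ₁ - w)]
    _ ≤ 100 * c * γ := by linarith

/-- The critical contribution is `q₂²/x₂`, bounded exactly because `γ₂² ≤ γ ≤ x₂`. -/
theorem mul_transverse_slope_sq_le {γ γ₂ x₁ x₂ p₂ q₂ : ℝ} (hγ : 0 < γ) (hγ' : γ ≤ 1)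
    (hγ₂γ : γ₂ ^ 2 ≤ γ) (hx₁ : 1 ≤ x₁) (hx₂ : γ ≤ x₂) (hx₂' : x₂ ≤ 2 * γ)
    (hp₂ : |p₂| ≤ γ₂) (hq₂ : |q₂| ≤ γ₂) : x₂ * (p₂ / x₁ - q₂ / x₂) ^ 2 ≤ 6 := by
  have hx20 : 0 < x₂ := by linarith
  have hsq {r : ℝ} (hr : |r| ≤ γ₂) : r ^ 2 ≤ γ := by
    refine le_trans ?_ hγ₂γ
    rw [← sq_abs]
    gcongr
  have hp2 := hsq hp₂
  have hq2 := hsq hq₂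
  have e1 : (p₂ / x₁ - q₂ / x₂) ^ 2 ≤ 2 * (p₂ ^ 2 / x₁ ^ 2) + 2 * (q₂ ^ 2 / x₂ ^ 2) := by
    rw [← div_pow, ← div_pow]
    linarith [sq_nonneg (p₂ / x₁ + q₂ / x₂)]
  have e2 : p₂ ^ 2 / x₁ ^ 2 ≤ 1 := by
    rw [div_le_one (by positivity)]
    linarith [one_le_pow₀ hx₁ (n := 2)]
  have e3 : q₂ ^ 2 / x₂ ≤ 1 := by
    rw [div_le_one hx20]
    linarith
  have e4 : x₂ ≤ 2 := by linarith
  calc x₂ * (p₂ / x₁ - q₂ / x₂) ^ 2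
      ≤ x₂ * (2 * (p₂ ^ 2 / x₁ ^ 2) + 2 * (q₂ ^ 2 / x₂ ^ 2)) := by gcongr
    _ = 2 * (x₂ * (p₂ ^ 2 / x₁ ^ 2)) + 2 * (q₂ ^ 2 / x₂) := by field_simp
    _ ≤ 2 * (2 * 1) + 2 * 1 := by gcongr
    _ = 6 := by norm_num

/-- The transverse resonance is `x₁x₂/(x₁+x₂) · |p/x₁ - q/x₂|²`, depending only on the difference of
slopes. Here it is expanded around the slope difference `(M, 0)`. -/
theorem transverse_identity {M x₁ x₂ p₁ p₂ q₁ q₂ : ℝ} (hx₁ : 0 < x₁) (hx₂ : 0 < x₂) :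
    (p₁ ^ 2 + p₂ ^ 2) / x₁ + (q₁ ^ 2 + q₂ ^ 2) / x₂
        - ((p₁ + q₁) ^ 2 + (p₂ + q₂) ^ 2) / (x₁ + x₂) - x₂ * M ^ 2
      = x₁ / (x₁ + x₂) * (2 * (M * (x₂ * (p₁ / x₁ - q₁ / x₂ - M)))
          + (x₂ * (p₁ / x₁ - q₁ / x₂ - M)) ^ 2 / x₂ + x₂ * (p₂ / x₁ - q₂ / x₂) ^ 2)
        - x₂ ^ 2 * M ^ 2 / (x₁ + x₂) := by
  field_simp
  ring

/-- The transverse part of the resonance function is close to `x₂ M²`. -/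
theorem abs_transverse_sub_le {N M γ γ₁ γ₂ c x₁ x₂ p₁ p₂ q₁ q₂ : ℝ} (hN : 10 ≤ N) (hγ : 0 < γ)
    (hγ' : γ ≤ 1) (hM : 0 ≤ M) (hc : 1 ≤ c) (hγ₁ : 0 ≤ γ₁) (hM1 : M ^ 2 * γ ^ 2 ≤ c * N)
    (hM2 : M * γ₁ ≤ c) (hγ₁γ : γ₁ ^ 2 ≤ γ) (hγ₂γ : γ₂ ^ 2 ≤ γ)
    (hx₁ : |x₁ - N| ≤ γ) (hx₂ : γ ≤ x₂) (hx₂' : x₂ ≤ 2 * γ) (hp₁ : |p₁ - M * N| ≤ γ₁)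
    (hp₂ : |p₂| ≤ γ₂) (hq₁ : |q₁| ≤ γ₁) (hq₂ : |q₂| ≤ γ₂) :
    |(p₁ ^ 2 + p₂ ^ 2) / x₁ + (q₁ ^ 2 + q₂ ^ 2) / x₂
        - ((p₁ + q₁) ^ 2 + (p₂ + q₂) ^ 2) / (x₁ + x₂) - x₂ * M ^ 2| ≤ 200 * c := by
  have hx₁' := abs_le.1 hx₁
  have hx1 : N / 2 ≤ x₁ := by linarith
  have hx10 : 0 < x₁ := by linarith
  have hx20 : 0 < x₂ := by linarith
  have hd := abs_mul_slope_sub_le hN hγ hγ' hM hγ₁ hx₁ hx₂ hx₂' hp₁ hq₁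
  have hA := mul_slope_bound_le hN hγ' hM hc hγ₁ hM1 hM2
  have hB := slope_bound_sq_le hN hγ hγ' hM hc hγ₁ hM1 hγ₁γ
  have hC := mul_transverse_slope_sq_le hγ hγ' hγ₂γ (by linarith : 1 ≤ x₁) hx₂ hx₂' hp₂ hq₂
  rw [transverse_identity hx10 hx20]
  set d := x₂ * (p₁ / x₁ - q₁ / x₂ - M)
  set b := x₂ * (p₂ / x₁ - q₂ / x₂) ^ 2 with hb
  set X := 4 * γ * (γ₁ + M * γ) / N + γ₁
  have hb0 : 0 ≤ b := by positivity
  have hA' : |M * d| ≤ 9 * c := by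
    rw [abs_mul, abs_of_nonneg hM]
    exact (mul_le_mul_of_nonneg_left hd hM).trans hA
  have hB' : d ^ 2 / x₂ ≤ 100 * c := by
    rw [div_le_iff₀ hx20]
    have h1 : d ^ 2 ≤ X ^ 2 := by
      rw [← sq_abs]
      exact pow_le_pow_left₀ (abs_nonneg _) hd 2
    have h2 : 100 * c * γ ≤ 100 * c * x₂ := mul_le_mul_of_nonneg_left hx₂ (by linarith)
    linarith
  have hB0 : 0 ≤ d ^ 2 / x₂ := by positivity
  have hD : x₂ ^ 2 * M ^ 2 / (x₁ + x₂) ≤ 8 * c := by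
    rw [div_le_iff₀ (by linarith)]
    have h1 : x₂ ^ 2 ≤ (2 * γ) ^ 2 := pow_le_pow_left₀ hx20.le hx₂' 2
    have h2 : x₂ ^ 2 * M ^ 2 ≤ (2 * γ) ^ 2 * M ^ 2 :=
      mul_le_mul_of_nonneg_right h1 (sq_nonneg M)
    have h3 : c * N ≤ c * (2 * (x₁ + x₂)) := mul_le_mul_of_nonneg_left (by linarith) (by linarith)
    linarith
  have hD0 : 0 ≤ x₂ ^ 2 * M ^ 2 / (x₁ + x₂) := by positivity
  have hθ0 : 0 ≤ x₁ / (x₁ + x₂) := by positivity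
  have hθ1 : x₁ / (x₁ + x₂) ≤ 1 := by rw [div_le_one (by positivity)]; linarith
  have hE : |2 * (M * d) + d ^ 2 / x₂ + b| ≤ 124 * c := by
    have := abs_le.1 hA'
    rw [abs_le]
    constructor <;> linarith [this.1, this.2]
  refine (abs_sub _ _).trans ?_
  rw [abs_mul, abs_of_nonneg hθ0, abs_of_nonneg hD0]
  have := (mul_le_of_le_one_left (abs_nonneg (2 * (M * d) + d ^ 2 / x₂ + b)) hθ1).trans hE
  linarith

/-- For `x₁` near `N` and small `x₂`, the increment of `x ^ (α + 1)` is `(α + 1) N ^ α x₂` up to a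
bounded error. -/
theorem abs_longitudinal_sub_le {α N γ x₁ x₂ : ℝ} (hα : 0 < α) (hN : 10 ≤ N) (hγ : 0 < γ)
    (hγ' : γ ≤ 1) (hγN : γ ^ 2 * N ^ (α - 1) ≤ 1) (hx₁ : |x₁ - N| ≤ γ) (hx₂ : γ ≤ x₂)
    (hx₂' : x₂ ≤ 2 * γ) :
    |(x₁ + x₂) ^ (α + 1) - x₁ ^ (α + 1) - x₂ ^ (α + 1) - x₂ * ((α + 1) * N ^ α)|
      ≤ 6 * (α + 1) * α * 2 ^ |α - 1| + 2 ^ (α + 1) := by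
  rw [abs_le] at hx₁
  have hx20 : 0 < x₂ := by linarith
  obtain ⟨z, hz, hz'⟩ := exists_hasDerivAt_eq_slope (fun x : ℝ => x ^ (α + 1))
    (fun x => (α + 1) * x ^ α) (by linarith : x₁ < x₁ + x₂)
    (fun x hx => (Real.continuousAt_rpow_const x _ (Or.inl (by linarith [hx.1]))).continuousWithinAt)
    (fun x hx => by
      have := Real.hasDerivAt_rpow_const (x := x) (p := α + 1) (Or.inl (by linarith [hx.1]))
      simpa using this)
  have e1 : (x₁ + x₂) ^ (α + 1) - x₁ ^ (α + 1) = x₂ * ((α + 1) * z ^ α) := by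
    rw [hz', add_sub_cancel_left]
    field_simp
  have hzN : |z - N| ≤ 3 * γ := by
    rw [abs_le]; constructor <;> linarith [hz.1, hz.2]
  have e2 : |z ^ α - N ^ α| ≤ α * (2 ^ |α - 1| * N ^ (α - 1)) * |z - N| := by
    have := (convex_Icc (N / 2) (2 * N)).norm_image_sub_le_of_norm_hasDerivWithin_le
      (f := fun x : ℝ => x ^ α) (f' := fun x => α * x ^ (α - 1))
      (C := α * (2 ^ |α - 1| * N ^ (α - 1))) (x := N) (y := z)
      (fun x hx => (Real.hasDerivAt_rpow_const (Or.inl (by linarith [hx.1]))).hasDerivWithinAt)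
      (fun x hx => by
        have hx0 : 0 < x := by linarith [hx.1]
        rw [norm_mul, Real.norm_of_nonneg hα.le, Real.norm_of_nonneg (by positivity)]
        gcongr
        exact rpow_le_mul_rpow hx0 (by linarith) (by norm_num) hx.2 (by linarith [hx.1]) _)
      ⟨by linarith, by linarith⟩ ⟨by linarith [hz.1], by linarith [hz.2]⟩
    simpa using this
  have e3 : x₂ ^ (α + 1) ≤ 2 ^ (α + 1) := Real.rpow_le_rpow hx20.le (by linarith) (by linarith)
  have e4 : 0 ≤ x₂ ^ (α + 1) := by positivity
  have e5 : |x₂ * ((α + 1) * (z ^ α - N ^ α))| ≤ 6 * (α + 1) * α * 2 ^ |α - 1| := by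
    have hNα : 0 < N ^ (α - 1) := Real.rpow_pos_of_pos (by linarith) _
    rw [abs_mul, abs_mul, abs_of_pos hx20, abs_of_pos (by linarith : 0 < α + 1)]
    calc x₂ * ((α + 1) * |z ^ α - N ^ α|)
        ≤ 2 * γ * ((α + 1) * (α * (2 ^ |α - 1| * N ^ (α - 1)) * (3 * γ))) := by
          gcongr
          exact e2.trans (by gcongr)
      _ = 6 * (α + 1) * α * 2 ^ |α - 1| * (γ ^ 2 * N ^ (α - 1)) := by ring
      _ ≤ 6 * (α + 1) * α * 2 ^ |α - 1| * 1 := by gcongr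
      _ = _ := by ring
  have e6 : (x₁ + x₂) ^ (α + 1) - x₁ ^ (α + 1) - x₂ ^ (α + 1) - x₂ * ((α + 1) * N ^ α)
      = x₂ * ((α + 1) * (z ^ α - N ^ α)) - x₂ ^ (α + 1) := by
    rw [e1]; ring
  rw [e6]
  refine (abs_sub _ _).trans ?_
  rw [abs_of_nonneg e4]
  linarith

/-- For `α ≤ 0` the derivative of `x^(α+1)` is bounded on `[1, ∞)`, so boxes of unit size need no
cancellation. -/
theorem abs_longitudinal_le_of_nonpos {α N x₁ x₂ : ℝ} (hα : α ≤ 0) (hN : 10 ≤ N)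
    (hx₁ : |x₁ - N| ≤ 1) (hx₂ : 1 ≤ x₂) (hx₂' : x₂ ≤ 2) :
    |(x₁ + x₂) ^ (α + 1) - x₁ ^ (α + 1) - x₂ ^ (α + 1)| ≤ 2 * |α + 1| + 2 ^ |α + 1| := by
  rw [abs_le] at hx₁
  have hx20 : 0 < x₂ := by linarith
  obtain ⟨z, hz, hz'⟩ := exists_hasDerivAt_eq_slope (fun x : ℝ => x ^ (α + 1))
    (fun x => (α + 1) * x ^ α) (by linarith : x₁ < x₁ + x₂)
    (fun x hx => (Real.continuousAt_rpow_const x _ (Or.inl (by linarith [hx.1]))).continuousWithinAt)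
    (fun x hx => by
      have := Real.hasDerivAt_rpow_const (x := x) (p := α + 1) (Or.inl (by linarith [hx.1]))
      simpa using this)
  have e1 : (x₁ + x₂) ^ (α + 1) - x₁ ^ (α + 1) = x₂ * ((α + 1) * z ^ α) := by
    rw [hz', add_sub_cancel_left]
    field_simp
  have hz1 : 1 ≤ z := by linarith [hz.1]
  have e2 : z ^ α ≤ 1 := Real.rpow_le_one_of_one_le_of_nonpos hz1 hα
  have e3 : x₂ ^ (α + 1) ≤ 2 ^ |α + 1| :=
    (Real.rpow_le_rpow_of_exponent_le hx₂ (le_abs_self _)).trans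
      (Real.rpow_le_rpow hx20.le hx₂' (abs_nonneg _))
  rw [e1]
  refine (abs_sub _ _).trans ?_
  rw [abs_mul, abs_mul, abs_of_pos hx20, abs_of_nonneg (by positivity : 0 ≤ z ^ α),
    abs_of_nonneg (by positivity : 0 ≤ x₂ ^ (α + 1))]
  have : x₂ * (|α + 1| * z ^ α) ≤ 2 * (|α + 1| * 1) := by gcongr
  linarith

/-- The resonance function `ω(ξ₁, p) + ω(ξ₂, q) - ω(ξ₁ + ξ₂, p + q)` for positive frequencies. -/
def resonance (α x₁ x₂ p₁ p₂ q₁ q₂ : ℝ) : ℝ :=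
  x₁ ^ (α + 1) + x₂ ^ (α + 1) - (x₁ + x₂) ^ (α + 1) + ((p₁ ^ 2 + p₂ ^ 2) / x₁
    + (q₁ ^ 2 + q₂ ^ 2) / x₂ - ((p₁ + q₁) ^ 2 + (p₂ + q₂) ^ 2) / (x₁ + x₂))

/-- Boxes of arbitrarily large interaction on which the resonance function stays bounded. -/
theorem exists_resonant_boxes {α : ℝ} (hα : α < 15 / 7) :
    ∃ C : ℝ, 0 < C ∧ ∀ B : ℝ, ∃ N M γ γ₁ γ₂ : ℝ, 10 ≤ N ∧ 0 < γ ∧ γ ≤ 1 ∧ 0 < γ₁ ∧ γ₁ ≤ 1 ∧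
      0 < γ₂ ∧ γ₂ ≤ 1 ∧ B ≤ N ^ 2 * (γ * γ₁ * γ₂) ∧
      ∀ x₁ x₂ p₁ p₂ q₁ q₂ : ℝ, |x₁ - N| ≤ γ → γ ≤ x₂ → x₂ ≤ 2 * γ → |p₁ - M * N| ≤ γ₁ →
        |p₂| ≤ γ₂ → |q₁| ≤ γ₁ → |q₂| ≤ γ₂ → |resonance α x₁ x₂ p₁ p₂ q₁ q₂| ≤ C := by
  rcases le_or_gt α 0 with h0 | h0
  · refine ⟨2 * |α + 1| + 2 ^ |α + 1| + 200 * 1, by positivity, fun B => ?_⟩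
    -- With slope `M = 0` and unit boxes the interaction strength is `N²`, and `N² ≥ B`.
    refine ⟨max 10 B, 0, 1, 1, 1, le_max_left _ _, one_pos, le_rfl, one_pos, le_rfl, one_pos,
      le_rfl, ?_, ?_⟩
    · have h1 := le_max_left 10 B
      have h2 := le_max_right 10 B
      nlinarith
    · intro x₁ x₂ p₁ p₂ q₁ q₂ h1 h2 h3 h4 h5 h6 h7
      have hN := le_max_left 10 B
      have a1 := abs_longitudinal_le_of_nonpos h0 hN h1 h2 (by linarith)
      have a2 := abs_transverse_sub_le (c := 1) hN one_pos le_rfl le_rfl le_rfl zero_le_one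
        (by nlinarith) (by norm_num) (by norm_num) (by norm_num) h1 h2 h3 h4 h5 h6 h7
      rw [abs_le] at a1 a2 ⊢
      unfold resonance
      constructor <;> linarith [a1.1, a1.2, a2.1, a2.2]
  -- `γ = N^(-a)` is the largest such power at most `1` with `γ² N^(α-1) ≤ 1`. This bounds the
  -- linearisation error and also gives `M²γ² ≲ N`.
  · set a := max 0 ((α - 1) / 2) with ha
    have ha0 : 0 ≤ a := le_max_left _ _
    have ha1 : (α - 1) / 2 ≤ a := le_max_right _ _
    have haα : a ≤ α := max_le h0.le (by linarith)
    -- This is the exponent of `N² γγ₁γ₂`. For `α > 1` it equals `(11 - 5α)/4`, positive because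
    -- `15/7 < 11/5`.
    have he : 0 < 2 - 3 / 2 * a - α / 2 := by
      rcases max_cases 0 ((α - 1) / 2) with h | h <;> rw [ha, h.1] <;> linarith
    refine ⟨6 * (α + 1) * α * 2 ^ |α - 1| + 2 ^ (α + 1) + 200 * (α + 1), by positivity,
      fun B => ?_⟩
    obtain ⟨N, hN, hB⟩ : ∃ N : ℝ, 10 ≤ N ∧ B ≤ N ^ (2 - 3 / 2 * a - α / 2) :=
      ((eventually_ge_atTop 10).and ((tendsto_rpow_atTop he).eventually_ge_atTop B)).exists
    have hN0 : 0 < N := by linarith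
    have hN1 : 1 ≤ N := by linarith
    have hle {x y : ℝ} (h : x ≤ y) : N ^ x ≤ N ^ y := Real.rpow_le_rpow_of_exponent_le hN1 h
    have hle1 {x : ℝ} (h : x ≤ 0) : N ^ x ≤ 1 := Real.rpow_le_one_of_one_le_of_nonpos hN1 h
    have hsq (x : ℝ) : (N ^ x) ^ 2 = N ^ (2 * x) := by
      rw [sq, ← Real.rpow_add hN0]; ring_nf
    have hsqrt : √(α + 1) ^ 2 = α + 1 := Real.sq_sqrt (by linarith)
    have hsqrt1 : √(α + 1) ≤ α + 1 := by
      rw [Real.sqrt_le_left (by linarith)]; nlinarith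
    have hM2 : (√(α + 1) * N ^ (α / 2)) ^ 2 = (α + 1) * N ^ α := by
      rw [mul_pow, hsqrt, hsq]; ring_nf
    -- `M² = (α+1) N^α` cancels the two main terms; `γ₁ = N^(-α/2)` makes `Mγ₁` bounded, and `γ₂ =
    -- γ^(1/2)` is the largest width with `γ₂² ≤ γ`.
    refine ⟨N, √(α + 1) * N ^ (α / 2), N ^ (-a), N ^ (-(α / 2)), N ^ (-(a / 2)), hN,
      by positivity, hle1 (by linarith), by positivity, hle1 (by linarith), by positivity,
      hle1 (by linarith), ?_, ?_⟩
    · refine hB.trans (le_of_eq ?_)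
      rw [← Real.rpow_add hN0, ← Real.rpow_add hN0, ← Real.rpow_natCast N 2, ← Real.rpow_add hN0]
      congr 1
      push_cast
      ring
    · intro x₁ x₂ p₁ p₂ q₁ q₂ h1 h2 h3 h4 h5 h6 h7
      have a1 := abs_longitudinal_sub_le h0 hN (by positivity) (hle1 (by linarith)) (by
        rw [hsq, ← Real.rpow_add hN0]
        exact hle1 (by linarith)) h1 h2 h3
      have a2 := abs_transverse_sub_le (c := α + 1) hN (by positivity) (hle1 (by linarith))
        (by positivity) (by linarith) (by positivity) (by
          rw [hM2, hsq, mul_assoc, ← Real.rpow_add hN0]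
          gcongr
          calc N ^ (α + 2 * -a) ≤ N ^ (1 : ℝ) := hle (by linarith)
            _ = N := Real.rpow_one N) (by
          rw [mul_assoc, ← Real.rpow_add hN0, add_neg_cancel, Real.rpow_zero, mul_one]
          exact hsqrt1) (by
          rw [hsq]
          exact hle (by linarith)) (by
          rw [hsq]
          exact hle (by linarith)) h1 h2 h3 h4 h5 h6 h7
      rw [hM2] at a2
      rw [abs_le] at a1 a2 ⊢
      unfold resonance
      constructor <;> linarith [a1.1, a1.2, a2.1, a2.2]


/-! ### Boxes in frequency space -/

/-- The box with centre `b` and half-widths `r` in the angular frequency variables. -/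
def freqBox (b r : Fin 3 → ℝ) : Set Space := {k | ∀ i, |2 * Real.pi * k i - b i| ≤ r i}

theorem mem_freqBox {b₀ b₁ b₂ r₀ r₁ r₂ : ℝ} {k : Space} :
    k ∈ freqBox ![b₀, b₁, b₂] ![r₀, r₁, r₂] ↔ |xi k - b₀| ≤ r₀ ∧
      |2 * Real.pi * k 1 - b₁| ≤ r₁ ∧ |2 * Real.pi * k 2 - b₂| ≤ r₂ := by
  change (∀ i, _) ↔ _
  rw [Fin.forall_fin_succ, Fin.forall_fin_succ, Fin.forall_fin_succ]
  simp [xi]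

theorem freqBox_eq_preimage (b r : Fin 3 → ℝ) : freqBox b r =
    (WithLp.ofLp : Space → Fin 3 → ℝ) ⁻¹'
      Icc (fun i => (b i - r i) / (2 * Real.pi)) (fun i => (b i + r i) / (2 * Real.pi)) := by
  ext k
  change (∀ i, _) ↔ ((∀ i, _) ∧ ∀ i, _)
  rw [← forall_and]
  refine forall_congr' fun i => ?_
  have hpi : 0 < 2 * Real.pi := by positivity
  rw [abs_le, div_le_iff₀ hpi, le_div_iff₀ hpi, mul_comm (k.ofLp i)]
  constructor <;> rintro ⟨h1, h2⟩ <;> constructor <;> linarith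

theorem isCompact_freqBox (b r : Fin 3 → ℝ) : IsCompact (freqBox b r) := by
  rw [freqBox_eq_preimage]
  exact (PiLp.homeomorph 2 (fun _ : Fin 3 => ℝ)).isCompact_preimage.2 isCompact_Icc

theorem volume_freqBox (b r : Fin 3 → ℝ) :
    volume (freqBox b r) = ∏ i, ENNReal.ofReal (r i / Real.pi) := by
  rw [freqBox_eq_preimage, (PiLp.volume_preserving_ofLp (Fin 3)).measure_preimage
    measurableSet_Icc.nullMeasurableSet, Real.volume_Icc_pi]
  refine Finset.prod_congr rfl fun i _ => ?_
  congr 1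
  field_simp
  ring

theorem volume_freqBox_eq (b : Fin 3 → ℝ) {r₀ r₁ r₂ : ℝ} (h₀ : 0 ≤ r₀) (h₁ : 0 ≤ r₁) :
    volume (freqBox b ![r₀, r₁, r₂]) = ENNReal.ofReal (r₀ * r₁ * r₂ / Real.pi ^ 3) := by
  rw [volume_freqBox, Fin.prod_univ_three]
  simp only [Matrix.cons_val_zero, Matrix.cons_val_one, Matrix.cons_val]
  rw [← ENNReal.ofReal_mul (by positivity), ← ENNReal.ofReal_mul (by positivity)]
  congr 1
  ring

theorem omega_of_pos {α : ℝ} {k : Space} (hk : 0 < xi k) :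
    omega α k = xi k ^ (α + 1) + etaSq k / xi k := by
  rw [omega, abs_of_pos hk, Real.rpow_add_one hk.ne']

theorem omega_add_sub_eq_resonance (α : ℝ) {l m : Space} (hl : 0 < xi l) (hm : 0 < xi m) :
    omega α l + omega α m - omega α (l + m) =
      resonance α (xi l) (xi m) (2 * Real.pi * l 1) (2 * Real.pi * l 2) (2 * Real.pi * m 1)
        (2 * Real.pi * m 2) := by
  have h : 0 < xi (l + m) := by rw [xi_add]; positivity
  rw [omega_of_pos hl, omega_of_pos hm, omega_of_pos h, resonance, xi_add]
  simp only [etaSq, PiLp.add_apply]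
  ring

/-- The second iterate of a datum concentrated on two interacting boxes is large. -/
theorem exists_large_secondIterate {α : ℝ} (hα : α < 15 / 7) (s₁ s₂ : ℝ) {T : ℝ} (hT : 0 < T) :
    ∃ t ∈ Icc 0 T, ∀ C : ℝ, 0 ≤ C → ∃ f : L2, IsRealValued (f : Tempered) ∧ MemEnergyInfty f ∧
      Integrable (fun k => |xi k| * ‖(𝓕 f : L2) k‖) ∧
      MemLp (fun k => (weight s₁ s₂ k : ℂ) * (𝓕 f : L2) k) 2 volume ∧
      ENNReal.ofReal C * eLpNorm (fun k => (weight s₁ s₂ k : ℂ) * (𝓕 f : L2) k) 2 volume ^ 2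
        < eLpNorm (fun k => (weight s₁ s₂ k : ℂ) * secondIterate α f t k) 2 volume := by
  obtain ⟨R, hR, hbox⟩ := exists_resonant_boxes hα
  -- The time depends only on the resonance bound and `T`, not on `C` or `N`, so it stays fixed
  -- while the boxes move to high frequency.
  set t := min T (1 / R) with ht
  have ht0 : 0 < t := lt_min hT (by positivity)
  have htR : R * t ≤ 1 := by
    calc R * t ≤ R * (1 / R) := by gcongr; exact min_le_right _ _
      _ = 1 := by field_simp
  refine ⟨t, ⟨ht0.le, min_le_left _ _⟩, fun C hC => ?_⟩
  set Q : ℝ := 10 ^ |s₁ / 2| * 10 ^ |s₂ / 2| with hQ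
  have hQ0 : 0 < Q := by positivity
  -- Chosen so that the final inequality reduces to `A < N √V`: `36` is twice the `18` from the
  -- volume of `D`, the `2` undoing the `1/2` in the lower bound for the iterate.
  set A : ℝ := 36 * C * Q ^ 2 / t with hA
  have hA0 : 0 ≤ A := by positivity
  obtain ⟨N, M, γ, γ₁, γ₂, hN, hγ, hγ', hγ₁, hγ₁', hγ₂, hγ₂', hB, hres⟩ :=
    hbox (8 * Real.pi ^ 3 * (A ^ 2 + 1))
  set V : ℝ := γ / 2 * (γ₁ / 2) * (γ₂ / 2) / Real.pi ^ 3 with hV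
  have hV0 : 0 < V := by positivity
  -- `D₂` and the output box `K` have half the widths of `D₁`, so that `K - D₂ ⊆ D₁`: for every
  -- output frequency in `K` all of `D₂` contributes. The reflected copies added to form `D` serve
  -- only to make the datum real.
  set D₁ := freqBox ![N, M * N, 0] ![γ, γ₁, γ₂] with hD₁
  set D₂ := freqBox ![3 / 2 * γ, 0, 0] ![γ / 2, γ₁ / 2, γ₂ / 2] with hD₂
  set K := freqBox ![N + 3 / 2 * γ, M * N, 0] ![γ / 2, γ₁ / 2, γ₂ / 2] with hK
  have vD₁ : volume D₁ = ENNReal.ofReal (8 * V) := by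
    rw [hD₁, volume_freqBox_eq _ hγ.le hγ₁.le]
    congr 1
    rw [hV]; ring
  have vD₂ : volume D₂ = ENNReal.ofReal V :=
    volume_freqBox_eq _ (by positivity) (by positivity)
  have vK : volume K = ENNReal.ofReal V :=
    volume_freqBox_eq _ (by positivity) (by positivity)
  set D := (D₁ ∪ D₂) ∪ Neg.neg ⁻¹' (D₁ ∪ D₂) with hD
  have hc₁₂ : IsCompact (D₁ ∪ D₂) := (isCompact_freqBox _ _).union (isCompact_freqBox _ _)
  have hDc : IsCompact D := hc₁₂.union ((Homeomorph.neg Space).isCompact_preimage.2 hc₁₂)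
  have hDneg : ∀ k ∈ D, -k ∈ D := by
    rintro k (h | h)
    · exact Or.inr (by simpa using h)
    · exact Or.inl h
  have x₁ {k : Space} (hk : k ∈ D₁) : N - γ ≤ xi k ∧ xi k ≤ N + γ := by
    have := abs_le.1 (mem_freqBox.1 hk).1
    constructor <;> linarith [this.1, this.2]
  have x₂ {k : Space} (hk : k ∈ D₂) : γ ≤ xi k ∧ xi k ≤ 2 * γ := by
    have := abs_le.1 (mem_freqBox.1 hk).1
    constructor <;> linarith [this.1, this.2]
  have xK {k : Space} (hk : k ∈ K) : N + γ ≤ xi k ∧ xi k ≤ N + 2 * γ := by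
    have := abs_le.1 (mem_freqBox.1 hk).1
    constructor <;> linarith [this.1, this.2]
  have hDxi : ∀ k ∈ D, xi k ≠ 0 := by
    rintro k ((h | h) | (h | h))
    · have := x₁ h; intro h0; linarith
    · have := x₂ h; intro h0; linarith
    · have := x₁ h; rw [xi_neg] at this; intro h0; linarith
    · have := x₂ h; rw [xi_neg] at this; intro h0; linarith
  have vD : volume D ≤ ENNReal.ofReal (18 * V) := by
    have h1 : volume (D₁ ∪ D₂) ≤ ENNReal.ofReal (9 * V) := by
      refine (measure_union_le _ _).trans (le_of_eq ?_)
      rw [vD₁, vD₂, ← ENNReal.ofReal_add (by positivity) hV0.le]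
      congr 1; ring
    refine (measure_union_le _ _).trans ?_
    rw [(Measure.measurePreserving_neg (volume : Measure Space)).measure_preimage
      hc₁₂.measurableSet.nullMeasurableSet]
    refine (add_le_add h1 h1).trans (le_of_eq ?_)
    rw [← ENNReal.ofReal_add (by positivity) (by positivity)]
    congr 1; ring
  obtain ⟨f, hfg, hreal, hE, hi, hm, hnorm⟩ := exists_datum s₁ s₂ hDc hDneg hDxi
  refine ⟨f, hreal, hE, hi, hm, ?_⟩
  set g : Space → ℝ := D.indicator (fun k => (weight s₁ s₂ k)⁻¹) with hg
  have hg0 (k : Space) : 0 ≤ g k :=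
    indicator_nonneg (fun k _ => (inv_pos.2 (weight_pos s₁ s₂ k)).le) k
  have hgD {k : Space} (h : g k ≠ 0) : k ∈ D := by
    by_contra h'
    exact h (indicator_of_notMem h' _)
  -- only the interaction of the two boxes contributes
  have hpair {k l : Space} (hk : k ∈ K) (hl : l ∈ D) (hkl : k - l ∈ D) :
      (l ∈ D₁ ∧ k - l ∈ D₂) ∨ (l ∈ D₂ ∧ k - l ∈ D₁) := by
    have a := xK hk
    have e : xi (k - l) = xi k - xi l := by rw [sub_eq_add_neg, xi_add, xi_neg, sub_eq_add_neg]
    rcases hl with (hl | hl) | (hl | hl) <;> rcases hkl with (hm | hm) | (hm | hm)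
    · have b := x₁ hl; have c := x₁ hm; rw [e] at c; exfalso; linarith
    · exact Or.inl ⟨hl, hm⟩
    · have b := x₁ hl; have c := x₁ hm; rw [xi_neg, e] at c; exfalso; linarith
    · have b := x₁ hl; have c := x₂ hm; rw [xi_neg, e] at c; exfalso; linarith
    · exact Or.inr ⟨hl, hm⟩
    · have b := x₂ hl; have c := x₂ hm; rw [e] at c; exfalso; linarith
    · have b := x₂ hl; have c := x₁ hm; rw [xi_neg, e] at c; exfalso; linarith
    · have b := x₂ hl; have c := x₂ hm; rw [xi_neg, e] at c; exfalso; linarith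
    · have b := x₁ hl; have c := x₁ hm; rw [xi_neg] at b; rw [e] at c; exfalso; linarith
    · have b := x₁ hl; have c := x₂ hm; rw [xi_neg] at b; rw [e] at c; exfalso; linarith
    · have b := x₁ hl; have c := x₁ hm; rw [xi_neg] at b; rw [xi_neg, e] at c; exfalso; linarith
    · have b := x₁ hl; have c := x₂ hm; rw [xi_neg] at b; rw [xi_neg, e] at c; exfalso; linarith
    · have b := x₂ hl; have c := x₁ hm; rw [xi_neg] at b; rw [e] at c; exfalso; linarith
    · have b := x₂ hl; have c := x₂ hm; rw [xi_neg] at b; rw [e] at c; exfalso; linarith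
    · have b := x₂ hl; have c := x₁ hm; rw [xi_neg] at b; rw [xi_neg, e] at c; exfalso; linarith
    · have b := x₂ hl; have c := x₂ hm; rw [xi_neg] at b; rw [xi_neg, e] at c; exfalso; linarith
  have hreso {l m : Space} (hl : l ∈ D₁) (hm : m ∈ D₂) :
      |omega α l + omega α m - omega α (l + m)| ≤ R := by
    have a := x₁ hl
    have b := x₂ hm
    rw [omega_add_sub_eq_resonance α (by linarith) (by linarith)]
    have hl' := mem_freqBox.1 hl
    have hm' := mem_freqBox.1 hm
    simp only [sub_zero] at hl' hm'
    exact hres _ _ _ _ _ _ hl'.1 b.1 b.2 hl'.2.1 hl'.2.2 (hm'.2.1.trans (by linarith))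
      (hm'.2.2.trans (by linarith))
  have hΩ {k : Space} (hk : k ∈ K) (l : Space) (h1 : g l ≠ 0) (h2 : g (k - l) ≠ 0) :
      |omega α l + omega α (k - l) - omega α k| * t ≤ 1 := by
    refine le_trans ?_ htR
    gcongr
    rcases hpair hk (hgD h1) (hgD h2) with ⟨h, h'⟩ | ⟨h, h'⟩
    · have := hreso h h'
      rwa [add_sub_cancel] at this
    · have := hreso h' h
      rwa [sub_add_cancel, add_comm (omega α (k - l))] at this
  have hsmall {m : Space} (hm : m ∈ D₂) : xi m ^ 2 ≤ 4 ∧ etaSq m ≤ 4 := by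
    have a := x₂ hm
    have b := (mem_freqBox.1 hm).2
    simp only [sub_zero] at b
    have b1 := abs_le.1 b.1
    have b2 := abs_le.1 b.2
    refine ⟨by nlinarith, ?_⟩
    unfold etaSq
    nlinarith
  have hmem {k l : Space} (hk : k ∈ K) (hl : l ∈ D₂) : k - l ∈ D₁ := by
    have a := mem_freqBox.1 hk
    have b := mem_freqBox.1 hl
    rw [hD₁, mem_freqBox]
    have e : xi (k - l) = xi k - xi l := by rw [sub_eq_add_neg, xi_add, xi_neg, sub_eq_add_neg]
    rw [e]
    simp only [PiLp.sub_apply, abs_le] at a b ⊢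
    obtain ⟨⟨a1, a2⟩, ⟨a3, a4⟩, a5, a6⟩ := a
    obtain ⟨⟨b1, b2⟩, ⟨b3, b4⟩, b5, b6⟩ := b
    refine ⟨⟨?_, ?_⟩, ⟨?_, ?_⟩, ?_, ?_⟩ <;> linarith
  have hlow {k : Space} (hk : k ∈ K) :
      Q⁻¹ ^ 2 * (weight s₁ s₂ k)⁻¹ * V ≤ ∫ l, g l * g (k - l) := by
    have hpt {l : Space} (hl : l ∈ D₂) : Q⁻¹ ^ 2 * (weight s₁ s₂ k)⁻¹ ≤ g l * g (k - l) := by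
      have hs := hsmall hl
      have w2 : weight s₁ s₂ l ≤ Q * weight s₁ s₂ 0 :=
        weight_le_mul_weight s₁ s₂ (k := 0) (l := l)
          (by rw [zero_sub, xi_neg, neg_sq]; exact hs.1) (by
            rw [zero_sub]
            have : etaSq (-l) = etaSq l := by simp [etaSq]
            rw [this]; exact hs.2)
      have w3 : weight s₁ s₂ (k - l) ≤ Q * weight s₁ s₂ k :=
        weight_le_mul_weight s₁ s₂ (by rw [sub_sub_cancel]; exact hs.1)
          (by rw [sub_sub_cancel]; exact hs.2)
      rw [weight_zero, mul_one] at w2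
      have hl' : l ∈ D := Or.inl (Or.inr hl)
      have hkl' : k - l ∈ D := Or.inl (Or.inl (hmem hk hl))
      simp only [hg]
      rw [indicator_of_mem hl', indicator_of_mem hkl']
      have p1 := weight_pos s₁ s₂ l
      have p2 := weight_pos s₁ s₂ (k - l)
      have p3 := weight_pos s₁ s₂ k
      calc Q⁻¹ ^ 2 * (weight s₁ s₂ k)⁻¹ = Q⁻¹ * (Q * weight s₁ s₂ k)⁻¹ := by
            rw [mul_inv]; ring
        _ ≤ _ := by gcongr
    have hint := integrable_mul_reflected hfg k
    have hD₂m : MeasurableSet D₂ := (isCompact_freqBox _ _).measurableSet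
    calc _ = ∫ l in D₂, Q⁻¹ ^ 2 * (weight s₁ s₂ k)⁻¹ := by
          rw [setIntegral_const, smul_eq_mul, Measure.real, vD₂, ENNReal.toReal_ofReal hV0.le]
          ring
      _ ≤ ∫ l in D₂, g l * g (k - l) := by
          refine setIntegral_mono_on ?_ hint.integrableOn hD₂m fun l hl => hpt hl
          exact integrableOn_const (by rw [vD₂]; exact ENNReal.ofReal_ne_top)
      _ ≤ _ := setIntegral_le_integral hint (ae_of_all _ fun l => mul_nonneg (hg0 _) (hg0 _))
  set κ : ℝ := N * (t / 2 * (Q⁻¹ ^ 2 * V)) with hκ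
  have hκ0 : 0 < κ := by positivity
  have hptK {k : Space} (hk : k ∈ K) :
      κ ≤ ‖(weight s₁ s₂ k : ℂ) * secondIterate α f t k‖ := by
    have h1 := le_norm_secondIterate ht0.le hg0 hfg (k := k) (hΩ hk)
    have hw := weight_pos s₁ s₂ k
    have hxiN : N ≤ |xi k| := by
      have := xK hk
      exact (by linarith : N ≤ xi k).trans (le_abs_self _)
    rw [norm_mul, Complex.norm_real, Real.norm_of_nonneg hw.le]
    calc κ = weight s₁ s₂ k * (N * (t / 2 * (Q⁻¹ ^ 2 * (weight s₁ s₂ k)⁻¹ * V))) := by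
          rw [hκ]; field_simp
      _ ≤ weight s₁ s₂ k * (|xi k| * (t / 2 * ∫ l, g l * g (k - l))) := by
          have := hlow hk
          gcongr
      _ ≤ _ := by gcongr
  have hlower : ENNReal.ofReal (κ * √V) ≤
      eLpNorm (fun k => (weight s₁ s₂ k : ℂ) * secondIterate α f t k) 2 volume := by
    have h1 : eLpNorm (K.indicator fun _ => κ) 2 volume = ENNReal.ofReal (κ * √V) := by
      rw [eLpNorm_indicator_const (isCompact_freqBox _ _).measurableSet (by norm_num)
        (by norm_num), vK, Real.enorm_of_nonneg hκ0.le,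
        ENNReal.ofReal_rpow_of_nonneg hV0.le (by norm_num), ← ENNReal.ofReal_mul hκ0.le,
        Real.sqrt_eq_rpow]
      simp
    rw [← h1]
    refine eLpNorm_mono fun k => ?_
    by_cases hk : k ∈ K
    · rw [indicator_of_mem hk, Real.norm_of_nonneg hκ0.le]
      exact hptK hk
    · rw [indicator_of_notMem hk, norm_zero]
      exact norm_nonneg _
  refine lt_of_lt_of_le ?_ hlower
  rw [hnorm]
  refine lt_of_le_of_lt (mul_le_mul_right vD _) ?_
  rw [← ENNReal.ofReal_mul hC, ENNReal.ofReal_lt_ofReal_iff (by positivity)]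
  -- The iterate is at least of order `N V` on a set of measure `V`, hence `N V^(3/2)` in `L²`,
  -- against `V` for the squared norm of the datum; the gain is `N √V`.
  have hNV : A < N * √V := by
    refine lt_of_pow_lt_pow_left₀ 2 (by positivity) ?_
    rw [mul_pow, Real.sq_sqrt hV0.le]
    have hpi : 0 < 8 * Real.pi ^ 3 := by positivity
    have : N ^ 2 * (γ * γ₁ * γ₂) = 8 * Real.pi ^ 3 * (N ^ 2 * V) := by
      rw [hV]; field_simp; norm_num
    rw [this] at hB
    linarith [le_of_mul_le_mul_left hB hpi]
  have e1 : C * (18 * V) = A * (t / 2 * (Q⁻¹ ^ 2 * V)) := by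
    rw [hA]; field_simp; ring
  have e2 : κ * √V = N * √V * (t / 2 * (Q⁻¹ ^ 2 * V)) := by rw [hκ]; ring
  rw [e1, e2]
  gcongr


end KPI

end

theorem mainTheorem3 (α : ℝ) (hα : α < 15 / 7) (s₁ s₂ : ℝ) :
    ¬ ∃ T : ℝ, 0 < T ∧
      ∃ (U : Set (KPI.Sobolev s₁ s₂))
        (Γ : KPI.Sobolev s₁ s₂ → C(Set.Icc (-T) T, KPI.Sobolev s₁ s₂)),
        KPI.IsFlowMap α s₁ s₂ T U Γ ∧ ContDiffAt ℝ 2 Γ 0 := by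
  rintro ⟨T, hT, U, Γ, hΓ, hC2⟩
  obtain ⟨C, hC, hbound⟩ := hΓ.exists_secondIterate_le hC2
  obtain ⟨t, ht, hlarge⟩ := KPI.exists_large_secondIterate hα s₁ s₂ hT
  obtain ⟨f, hr, hE, hi, hm, hlt⟩ := hlarge C hC
  exact absurd (hbound f hr hE hi hm t ht) (not_le.2 hlt)
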